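/- **Setting.** Let $E$ be a complex Banach space with dual $E'$. For a function $f$ that is holomorphic near $a$, write $\hat d^jf(a)$ for its $j$-th derivative at $a$, as a continuous $j$-homogeneous polynomial (so that $f(x)=\sum_j \frac1{j!}\hat d^jf(a)(x-a)$ near $a$). $\mathcal H(E)$ is the space of entire functions on $E$ and $\mathcal P({}^jE)$ the space of continuous $j$-homogeneous polynomials $E\to\mathbb C$. *Holomorphy type.* $\Theta$ is a sequence of Banach spaces $(\mathcal P_\Theta({}^jE),\|\cdot\|_\Theta)$, $j\ge 0$, each a vector subspace of $\mathcal P({}^jE)$, with $\mathcal P_\Theta({}^0E)=\mathbb C$ as a normed space, for which there is $\sigma\ge1$ such that for all $m\le j$, $a\in E$, $P\in\mathcal P_\Theta({}^jE)$ one has $\hat d^mP(a)\in\mathcal P_\Theta({}^mE)$ and $\|\frac1{m!}\hat d^mP(a)\|_\Theta\le\sigma^j\|P\|_\Theta\|a\|^{j-m}$. *Function spaces.* For $k\in[1,\infty]$ and $\rho>0$ let $$\|f\|_{\Theta,k,\rho}=\sum_{j\ge0}\rho^{-j}\Big(\frac{j}{ke}\Big)^{j/k}\Big\|\frac1{j!}\hat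 d^jf(0)\Big\|_\Theta,$$ where the factor $(j/ke)^{j/k}$ is read as $1$ if $j=0$ or $k=\infty$. $Exp^k_{\Theta,0}(E)$ is the space of all $f\in\mathcal H(E)$ with $\hat d^jf(0)\in\mathcal P_\Theta({}^jE)$ for all $j$ and $\|f\|_{\Theta,k,\rho}<\infty$ for all $\rho>0$, with the locally convex topology generated by the norms $\|\cdot\|_{\Theta,k,\rho}$, $\rho>0$; $[Exp^k_{\Theta,0}(E)]'$ is its topological dual. *$\pi_1$.* $\Theta$ is a $\pi_1$-holomorphy type if for every $j$ the span of $\{\varphi^j:\varphi\in E'\}$ is contained and dense in $\mathcal P_\Theta({}^jE)$, and there is $K>0$ with $\|b\,\varphi^j\|_\Theta\le K^j\|\varphi\|^j|b|$ for all $\varphi\in E'$, $b\in\mathbb C$, $j\ge0$. In that case the Borel transform $[\mathcal P_\Theta({}^jE)]'\ni T\mapsto(\varphi\mapsto T(\varphi^j))$ is injective; $\mathcal P_{\Theta'}({}^jE')$ denotes its range, with the norm $\|\cdot\|_{\Theta'}$ that makes it isometric. *$\pi_{2,k}$.* $\Theta$ is a $\pi_{2,k}$-holomorphy type if for every $T\in[Exp^k_{\Theta,0}(E)]'$: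 (1) whenever $m\le j$ and $B$ is a symmetric continuous $j$-linear form on $E$ whose polynomial $\hat B(x)=B(x,\dots,x)$ is in $\mathcal P_\Theta({}^jE)$, the function $T(\widehat{B\cdot^m}):y\mapsto T\big(x\mapsto B(\underbrace{x,\dots,x}_{m},\underbrace{y,\dots,y}_{j-m})\big)$ belongs to $\mathcal P_\Theta({}^{j-m}E)$; (2) for all $C,\rho>0$ with $|T(f)|\le C\|f\|_{\Theta,k,\rho}$ for all $f\in Exp^k_{\Theta,0}(E)$ there is $M>0$ with $\|T(\widehat{B\cdot^m})\|_\Theta\le C M^j\rho^{-m}(\frac m{ke})^{m/k}\|\hat B\|_\Theta$ for all $m\le j$ and $B$ as in (1) (with the same convention on the factor). *Target space.* For $k'\in[1,\infty)$, $Exp^{k'}_{\Theta'}(E')$ is the set of all $g\in\mathcal H(E')$ with $\hat d^jg(0)\in\mathcal P_{\Theta'}({}^jE')$ for all $j$ and, for some $\rho>0$, $\sum_{j}\rho^{-j}(\frac{j}{k'e})^{j/k'}\|\frac1{j!}\hat d^jg(0)\|_{\Theta'}<\infty$. **Theorem.** Let $k\in(1,\infty]$, let $\frac1k+\frac1{k'}=1$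 (so $k'=1$ if $k=\infty$), and let $\Theta$ be a holomorphy type from $E$ to $\mathbb C$ that is both a $\pi_1$- and a $\pi_{2,k}$-holomorphy type. Then: (a) For $f\in Exp^k_{\Theta,0}(E)$, $x\in E$ and $T\in[Exp^k_{\Theta,0}(E)]'$, the translate $\tau_{-x}f:y\mapsto f(y+x)$ and the function $T*f:x\mapsto T(\tau_{-x}f)$ belong to $Exp^k_{\Theta,0}(E)$, and $f\mapsto T*f$ is a continuous linear operator on $Exp^k_{\Theta,0}(E)$. Hence the product $(T_1*T_2)(f)=\big(T_1*(T_2*f)\big)(0)$ is defined on $[Exp^k_{\Theta,0}(E)]'$ and makes it a complex algebra with unit $\delta:f\mapsto f(0)$. (b) $Exp^{k'}_{\Theta'}(E')$ is a unital subalgebra of the algebra of all functions $E'\to\mathbb C$ with pointwise operations. (c) $e^\varphi\in Exp^k_{\Theta,0}(E)$ for every $\varphi\in E'$, and the Fourier–Borel transform $\mathcal F$, $\mathcal FT(\varphi)=T(e^\varphi)$, is an isomorphism of unital algebras from $[Exp^k_{\Theta,0}(E)]'$ (with $*$) onto $Exp^{k'}_{\Theta'}(E')$ (with pointwise multiplication).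 -/

import Mathlib

noncomputable section

open Filter Topology
open scoped ENNReal

namespace FourierBorel

/-! ### Homogeneous polynomials and derivatives -/

section Basic

variable {X : Type*} [NormedAddCommGroup X] [NormedSpace ℂ X]

/-- `P` is a continuous `j`-homogeneous polynomial on `X`. -/
def IsHomogPoly (j : ℕ) (P : X → ℂ) : Prop :=
  ∃ A : X [×j]→L[ℂ] ℂ, ∀ x, P x = A (fun _ => x)

/-- The `j`-th derivative of `f` at `a`, as a `j`-homogeneous polynomial. -/
def dhat (j : ℕ) (f : X → ℂ) (a : X) : X → ℂ :=
  fun x => iteratedFDeriv ℂ j f a (fun _ => x)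

/-- `f` is entire: near every point it is the sum of its Taylor series. -/
def Entire (f : X → ℂ) : Prop := AnalyticOnNhd ℂ f Set.univ

theorem Entire.contDiffAt {f : X → ℂ} (hf : Entire f) (a : X) (j : ℕ) :
    ContDiffAt ℂ j f a := (hf a (Set.mem_univ a)).contDiffAt

theorem Entire.zero : Entire (0 : X → ℂ) := fun _ _ => analyticAt_const

theorem Entire.add {f g : X → ℂ} (hf : Entire f) (hg : Entire g) : Entire (f + g) :=
  fun a ha => (hf a ha).add (hg a ha)

theorem Entire.smul (c : ℂ) {f : X → ℂ} (hf : Entire f) : Entire (c • f) :=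
  fun a ha => (hf a ha).const_smul

theorem dhat_zero (j : ℕ) (a : X) : dhat j (0 : X → ℂ) a = 0 := by
  funext x
  have h : iteratedFDeriv ℂ j (0 : X → ℂ) = 0 := iteratedFDeriv_fun_zero
  simp [dhat, h]

theorem dhat_add {f g : X → ℂ} (hf : Entire f) (hg : Entire g) (j : ℕ) (a : X) :
    dhat j (f + g) a = dhat j f a + dhat j g a := by
  funext x
  simp only [dhat, Pi.add_apply]
  rw [iteratedFDeriv_add_apply (hf.contDiffAt a j) (hg.contDiffAt a j)]
  rfl

theorem dhat_smul (c : ℂ) {f : X → ℂ} (hf : Entire f) (j : ℕ) (a : X) :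
    dhat j (c • f) a = c • dhat j f a := by
  funext x
  simp only [dhat, Pi.smul_apply]
  rw [iteratedFDeriv_const_smul_apply (hf.contDiffAt a j)]
  rfl

theorem IsHomogPoly.hasFPowerSeries {j : ℕ} (A : X [×j]→L[ℂ] ℂ) :
    ∃ p : FormalMultilinearSeries ℂ X ℂ,
      HasFPowerSeriesOnBall (fun x => A (fun _ => x)) p 0 ⊤ ∧ p j = A ∧ ∀ n, n ≠ j → p n = 0 := by
  classical
  let p : FormalMultilinearSeries ℂ X ℂ := fun n => if h : j = n then h ▸ A else 0
  have hpj : p j = A := by simp [p]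
  have hpn : ∀ n, n ≠ j → p n = 0 := fun n hn => by simp [p, hn.symm]
  refine ⟨p, ⟨?_, by simp, ?_⟩, hpj, hpn⟩
  · rw [top_le_iff]
    exact p.radius_eq_top_of_forall_image_add_eq_zero (j + 1) (fun m => hpn _ (by omega))
  · intro y _
    rw [zero_add]
    have := hasSum_single (f := fun n => p n (fun _ => y)) j
      (fun n hn => by simp [hpn n hn])
    simpa [hpj] using this

theorem IsHomogPoly.entire {j : ℕ} {P : X → ℂ} (hP : IsHomogPoly j P) : Entire P := by
  obtain ⟨A, hA⟩ := hP
  obtain rfl : P = fun x => A (fun _ => x) := funext hA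
  obtain ⟨p, hp, -, -⟩ := IsHomogPoly.hasFPowerSeries A
  intro a _
  exact hp.analyticAt_of_mem (by simp)

theorem IsHomogPoly.dhat_zero_self {j : ℕ} {P : X → ℂ} (hP : IsHomogPoly j P) :
    dhat j P 0 = (j.factorial : ℂ) • P := by
  obtain ⟨A, hA⟩ := hP
  obtain rfl : P = fun x => A (fun _ => x) := funext hA
  obtain ⟨p, hp, hpj, -⟩ := IsHomogPoly.hasFPowerSeries A
  funext x
  have := hp.factorial_smul x j
  rw [hpj] at this
  simp [dhat, ← this]

theorem IsHomogPoly.dhat_zero_of_ne {j n : ℕ} (hn : n ≠ j) {P : X → ℂ} (hP : IsHomogPoly j P) :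
    dhat n P 0 = 0 := by
  obtain ⟨A, hA⟩ := hP
  obtain rfl : P = fun x => A (fun _ => x) := funext hA
  obtain ⟨p, hp, -, hpn⟩ := IsHomogPoly.hasFPowerSeries A
  funext x
  have := hp.factorial_smul x n
  rw [hpn n hn] at this
  simpa [dhat] using this.symm

/-- The multilinear map `B` is symmetric. -/
def IsSymm {j : ℕ} (B : X [×j]→L[ℂ] ℂ) : Prop :=
  ∀ (s : Equiv.Perm (Fin j)) (v : Fin j → X), B (fun i => v (s i)) = B v

/-- The polynomial `x ↦ B(x, …, x, y, …, y)`, with `m` entries `x` and `j - m` entries `y`. -/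
def mixed {j : ℕ} (B : X [×j]→L[ℂ] ℂ) (m : ℕ) (y : X) : X → ℂ :=
  fun x => B (fun i => if (i : ℕ) < m then x else y)

theorem dhat_diag_eq_mixed {j m : ℕ} (hm : m ≤ j) {B : X [×j]→L[ℂ] ℂ} (hB : IsSymm B) (y : X) :
    dhat m (fun x => B (fun _ => x)) y = (j.descFactorial m : ℂ) • mixed B m y := by
  classical
  funext x
  let g : X →L[ℂ] (Fin j → X) := ContinuousLinearMap.pi (fun i => ContinuousLinearMap.id ℂ X)
  change iteratedFDeriv ℂ m (B ∘ g) y (fun _ => x) = _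
  rw [ContinuousLinearMap.iteratedFDeriv_comp_right _ B.contDiff _ le_rfl, B.iteratedFDeriv_eq]
  simp only [ContinuousMultilinearMap.iteratedFDeriv,
    ContinuousMultilinearMap.compContinuousLinearMap_apply, sum_apply,
    ContinuousMultilinearMap.iteratedFDerivComponent_apply, Set.mem_range, Pi.compRightL_apply]
  have key : ∀ e : Fin m ↪ Fin j,
      B (fun i => if (∃ a, e a = i) then x else y) = mixed B m y x := by
    intro e
    obtain ⟨s, hs⟩ := Equiv.Perm.exists_extending_pair (Fin.castLEEmb hm) e
      (Fin.castLEEmb hm).injective e.injective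
    rw [mixed, ← hB s]
    congr 1
    funext i
    have : (∃ a, e a = s i) ↔ (i : ℕ) < m := by
      constructor
      · rintro ⟨a, ha⟩
        rw [← hs a] at ha
        rw [← s.injective ha]
        exact a.2
      · intro hi
        exact ⟨⟨i, hi⟩, by rw [← hs]; rfl⟩
    simp [this]
  trans ∑ _e : Fin m ↪ Fin j, mixed B m y x
  · refine Finset.sum_congr rfl fun e _ => ?_
    rw [← key e]
    congr 1
  · simp [Fintype.card_embedding_eq]

end Basic

/-! ### Sequences of normed spaces of polynomials and the spaces `B^k_ρ` -/

/-- A sequence of vector spaces of functions on `X`, each with a norm. (The `j`-th space is going to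
consist of `j`-homogeneous polynomials.) -/
structure PolySpaces (X : Type*) [NormedAddCommGroup X] [NormedSpace ℂ X] where
  poly : ℕ → Submodule ℂ (X → ℂ)
  nrm : ∀ j, Seminorm ℂ (poly j)
  eq_zero_of_nrm : ∀ j P, nrm j P = 0 → P = 0

/-- The factor `(j / (k e))^(j / k)` (read as `1` if `k = ∞`). -/
def weight (k : ℝ≥0∞) (j : ℕ) : ℝ :=
  if k = ⊤ then 1 else ((j : ℝ) / (k.toReal * Real.exp 1)) ^ ((j : ℝ) / k.toReal)

theorem weight_nonneg (k : ℝ≥0∞) (j : ℕ) : 0 ≤ weight k j := by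
  unfold weight; split_ifs <;> positivity

namespace PolySpaces

variable {X : Type*} [NormedAddCommGroup X] [NormedSpace ℂ X] (Θ : PolySpaces X)

/-- The entire functions all of whose derivatives at `0` belong to the given spaces. -/
def regular : Submodule ℂ (X → ℂ) where
  carrier := {f | Entire f ∧ ∀ j, dhat j f 0 ∈ Θ.poly j}
  zero_mem' := ⟨Entire.zero, fun j => by rw [dhat_zero]; exact zero_mem _⟩
  add_mem' := fun hf hg => ⟨hf.1.add hg.1, fun j => by
    rw [dhat_add hf.1 hg.1]; exact add_mem (hf.2 j) (hg.2 j)⟩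
  smul_mem' := fun c _ hf => ⟨hf.1.smul c, fun j => by
    rw [dhat_smul c hf.1]; exact Submodule.smul_mem _ _ (hf.2 j)⟩

/-- The Taylor coefficient `(1 / j!) d̂^j f(0)`. -/
def taylor (j : ℕ) : Θ.regular →ₗ[ℂ] Θ.poly j where
  toFun f := (j.factorial : ℂ)⁻¹ • ⟨dhat j f 0, f.2.2 j⟩
  map_add' f g := by
    rw [← smul_add]
    congr 1
    exact Subtype.ext (dhat_add f.2.1 g.2.1 j 0)
  map_smul' c f := by
    rw [RingHom.id_apply, smul_comm]
    congr 1
    exact Subtype.ext (dhat_smul c f.2.1 j 0)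

/-- The `j`-th term of the series that defines `‖f‖_{k,ρ}`. -/
def term (k : ℝ≥0∞) (ρ : ℝ) (j : ℕ) (f : Θ.regular) : ℝ :=
  (ρ ^ j)⁻¹ * weight k j * Θ.nrm j (Θ.taylor j f)

variable {Θ} in
theorem term_nonneg (k : ℝ≥0∞) {ρ : ℝ} (hρ : 0 < ρ) (j : ℕ) (f : Θ.regular) :
    0 ≤ Θ.term k ρ j f := by
  have := weight_nonneg k j
  unfold term; positivity

variable {Θ} in
theorem term_add_le (k : ℝ≥0∞) {ρ : ℝ} (hρ : 0 < ρ) (j : ℕ) (f g : Θ.regular) :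
    Θ.term k ρ j (f + g) ≤ Θ.term k ρ j f + Θ.term k ρ j g := by
  have := weight_nonneg k j
  unfold term
  rw [map_add, ← mul_add]
  gcongr
  exact map_add_le_add _ _ _

variable {Θ} in
theorem term_smul (k : ℝ≥0∞) (ρ : ℝ) (j : ℕ) (c : ℂ) (f : Θ.regular) :
    Θ.term k ρ j (c • f) = ‖c‖ * Θ.term k ρ j f := by
  unfold term
  rw [map_smul, map_smul_eq_mul]
  ring

/-- The space `B^k_ρ` of all entire `f` with derivatives at `0` in the given spaces and with
`‖f‖_{k,ρ} = ∑ ρ^{-j} (j / (k e))^{j / k} ‖(1 / j!) d̂^j f(0)‖ < ∞`. -/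
def bSpace (k : ℝ≥0∞) (ρ : {ρ : ℝ // 0 < ρ}) : Submodule ℂ (X → ℂ) where
  carrier := {f | ∃ h : f ∈ Θ.regular, Summable fun j => Θ.term k ρ j ⟨f, h⟩}
  zero_mem' := ⟨zero_mem _, by
    have : ∀ j, Θ.term k ρ j ⟨0, zero_mem _⟩ = 0 := fun j => by
      change (_ * Θ.nrm j (Θ.taylor j 0)) = 0
      rw [map_zero, map_zero, mul_zero]
    simp only [this]
    exact summable_zero⟩
  add_mem' := by
    rintro f g ⟨hf, hf'⟩ ⟨hg, hg'⟩
    exact ⟨add_mem hf hg, Summable.of_nonneg_of_le (fun j => term_nonneg k ρ.2 j _)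
      (fun j => term_add_le k ρ.2 j ⟨f, hf⟩ ⟨g, hg⟩) (hf'.add hg')⟩
  smul_mem' := by
    rintro c f ⟨hf, hf'⟩
    refine ⟨Submodule.smul_mem _ c hf, ?_⟩
    have := hf'.mul_left ‖c‖
    simp only [← term_smul] at this
    exact this

/-- `⋂_{ρ > 0} B^k_ρ`. For `k = ∞` the condition `∑ ρ^{-j} ‖(1 / j!) d̂^j f(0)‖ < ∞` for all
`ρ > 0` says, by the root test, that `limsup ‖(1 / j!) d̂^j f(0)‖^{1/j} = 0`. -/
def expSubmodule (k : ℝ≥0∞) : Submodule ℂ (X → ℂ) := ⨅ ρ, Θ.bSpace k ρ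

/-- `⋃_{ρ > 0} B^k_ρ`, for `1 ≤ k < ∞`. -/
def expUnion (k : ℝ≥0∞) : Set (X → ℂ) := ⋃ ρ, (Θ.bSpace k ρ : Set (X → ℂ))

/-- `⋂_{ρ > 0} B^k_ρ` as a type of its own, so that it can carry its own topology. -/
def Exp (k : ℝ≥0∞) : Type _ := Θ.expSubmodule k

variable {Θ} {k : ℝ≥0∞}

instance : AddCommGroup (Θ.Exp k) := inferInstanceAs (AddCommGroup (Θ.expSubmodule k))
instance : Module ℂ (Θ.Exp k) := inferInstanceAs (Module ℂ (Θ.expSubmodule k))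

namespace Exp

/-- An element of the space, as a function. -/
def toFun (f : Θ.Exp k) : X → ℂ := f.1

/-- A function in the intersection, as an element of the space. -/
def mk (f : X → ℂ) (hf : f ∈ Θ.expSubmodule k) : Θ.Exp k := ⟨f, hf⟩

theorem ext {f g : Θ.Exp k} (h : ∀ x, f.toFun x = g.toFun x) : f = g :=
  Subtype.ext (funext h)

theorem mem_bSpace (f : Θ.Exp k) (ρ : {ρ : ℝ // 0 < ρ}) : f.toFun ∈ Θ.bSpace k ρ :=
  (Submodule.mem_iInf _).1 f.2 ρ

theorem mem_regular (f : Θ.Exp k) : f.toFun ∈ Θ.regular :=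
  (f.mem_bSpace ⟨1, one_pos⟩).1

/-- An element of the space, as a member of `regular`. -/
def reg (f : Θ.Exp k) : Θ.regular := ⟨f.toFun, f.mem_regular⟩

theorem summable_term (f : Θ.Exp k) (ρ : {ρ : ℝ // 0 < ρ}) :
    Summable fun j => Θ.term k ρ j f.reg := (f.mem_bSpace ρ).2

end Exp

variable (Θ k) in
/-- The norms `‖f‖_{k,ρ} = ∑ ρ^{-j} (j / (k e))^{j / k} ‖(1 / j!) d̂^j f(0)‖`, for `ρ > 0`. -/
def expNorm : SeminormFamily ℂ (Θ.Exp k) {ρ : ℝ // 0 < ρ} := fun ρ =>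
  Seminorm.of (fun f => ∑' j, Θ.term k ρ j f.reg)
    (fun f g => by
      rw [← (f.summable_term ρ).tsum_add (g.summable_term ρ)]
      exact (f + g).summable_term ρ |>.tsum_le_tsum (fun j => term_add_le k ρ.2 j f.reg g.reg)
        ((f.summable_term ρ).add (g.summable_term ρ)))
    (fun c f => by
      rw [← tsum_mul_left]
      exact tsum_congr fun j => term_smul k ρ j c f.reg)

/-- The projective limit topology: the one generated by the norms `‖·‖_{k,ρ}`, `ρ > 0`. -/
instance : TopologicalSpace (Θ.Exp k) :=
  haveI : Nonempty {ρ : ℝ // 0 < ρ} := ⟨⟨1, one_pos⟩⟩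
  (Θ.expNorm k).moduleFilterBasis.topology

theorem withSeminorms_expNorm : WithSeminorms (Θ.expNorm k) := ⟨rfl⟩

instance : IsTopologicalAddGroup (Θ.Exp k) := withSeminorms_expNorm.topologicalAddGroup
instance : ContinuousSMul ℂ (Θ.Exp k) := withSeminorms_expNorm.continuousSMul

variable (Θ) in
/-- The `j`-th space of the sequence, as a normed space. -/
def Space (j : ℕ) : Type _ := Θ.poly j

instance (j : ℕ) : AddCommGroup (Θ.Space j) := inferInstanceAs (AddCommGroup (Θ.poly j))
instance (j : ℕ) : Module ℂ (Θ.Space j) := inferInstanceAs (Module ℂ (Θ.poly j))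
instance (j : ℕ) : Norm (Θ.Space j) := ⟨fun P => Θ.nrm j P⟩

theorem spaceCore (j : ℕ) : NormedSpace.Core ℂ (Θ.Space j) where
  norm_nonneg P := apply_nonneg (Θ.nrm j) P
  norm_smul c P := map_smul_eq_mul (Θ.nrm j) c P
  norm_triangle P Q := map_add_le_add (Θ.nrm j) P Q
  norm_eq_zero_iff P := ⟨fun h => Θ.eq_zero_of_nrm j P h, fun h => by
    rw [h]; exact map_zero (Θ.nrm j)⟩

instance (j : ℕ) : NormedAddCommGroup (Θ.Space j) := NormedAddCommGroup.ofCore (spaceCore j)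
instance (j : ℕ) : NormedSpace ℂ (Θ.Space j) := NormedSpace.ofCore (spaceCore j)

end PolySpaces

/-! ### Holomorphy types -/

/-- A holomorphy type from `E` to `ℂ`: Banach spaces of continuous `j`-homogeneous polynomials, the
space for `j = 0` being `ℂ` (the constants) with its norm, such that
`‖(1 / m!) d̂^m P(a)‖ ≤ σ^j ‖P‖ ‖a‖^(j - m)` for some `σ ≥ 1` and all `m ≤ j`. -/
structure HolomorphyType (E : Type*) [NormedAddCommGroup E] [NormedSpace ℂ E]
    extends PolySpaces E where
  complete : ∀ j, CompleteSpace (toPolySpaces.Space j)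
  isHomogPoly : ∀ j, ∀ P ∈ poly j, IsHomogPoly j P
  const_mem : ∀ c : ℂ, (fun _ => c) ∈ poly 0
  nrm_const : ∀ c : ℂ, nrm 0 ⟨fun _ => c, const_mem c⟩ = ‖c‖
  dhat_mem : ∀ (m j : ℕ), m ≤ j → ∀ (a : E) (P : poly j), dhat m P a ∈ poly m
  exists_nrm_dhat_le : ∃ σ : ℝ, 1 ≤ σ ∧ ∀ (m j : ℕ) (hm : m ≤ j) (a : E) (P : poly j),
    nrm m ((m.factorial : ℂ)⁻¹ • ⟨dhat m P a, dhat_mem m j hm a P⟩) ≤ σ ^ j * nrm j P * ‖a‖ ^ (j - m)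

namespace HolomorphyType

variable {E : Type*} [NormedAddCommGroup E] [NormedSpace ℂ E] (Θ : HolomorphyType E)

variable {Θ} in
theorem poly_le_regular (j : ℕ) : Θ.poly j ≤ Θ.regular := fun P hP => by
  have h := Θ.isHomogPoly j P hP
  refine ⟨h.entire, fun n => ?_⟩
  by_cases hn : n = j
  · subst hn
    rw [h.dhat_zero_self]
    exact Submodule.smul_mem _ _ hP
  · rw [h.dhat_zero_of_ne hn]
    exact zero_mem _

variable {Θ} in
theorem poly_le_expSubmodule {k : ℝ≥0∞} (j : ℕ) : Θ.poly j ≤ Θ.expSubmodule k := fun P hP => by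
  refine (Submodule.mem_iInf _).2 fun ρ => ⟨poly_le_regular j hP, ?_⟩
  refine summable_of_ne_finset_zero (s := {j}) fun n hn => ?_
  have hn : n ≠ j := by simpa using hn
  have : Θ.taylor n ⟨P, poly_le_regular j hP⟩ = 0 := by
    have h0 : (⟨dhat n P 0, (poly_le_regular j hP).2 n⟩ : Θ.poly n) = 0 :=
      Subtype.ext ((Θ.isHomogPoly j P hP).dhat_zero_of_ne hn)
    change (n.factorial : ℂ)⁻¹ • (⟨dhat n P 0, (poly_le_regular j hP).2 n⟩ : Θ.poly n) = 0
    rw [h0, smul_zero]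
  simp [PolySpaces.term, this]

variable (E) in
/-- The `j`-homogeneous polynomials of finite type: the span of the powers `φ^j`, `φ ∈ E'`. -/
def finiteType (j : ℕ) : Submodule ℂ (E → ℂ) :=
  Submodule.span ℂ (Set.range fun (φ : StrongDual ℂ E) (x : E) => φ x ^ j)

theorem pow_mem_finiteType (φ : StrongDual ℂ E) (j : ℕ) :
    (fun x => φ x ^ j) ∈ finiteType E j := Submodule.subset_span ⟨φ, rfl⟩

/-- `Θ` is a `π₁`-holomorphy type. -/
structure IsPiOne : Prop where
  finiteType_le : ∀ j, finiteType E j ≤ Θ.poly j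
  exists_nrm_le : ∃ K : ℝ, 0 < K ∧ ∀ (φ : StrongDual ℂ E) (b : ℂ) (j : ℕ),
    Θ.nrm j (b • ⟨fun x => φ x ^ j, finiteType_le j (pow_mem_finiteType φ j)⟩)
      ≤ K ^ j * ‖φ‖ ^ j * ‖b‖
  dense : ∀ j, Dense {P : Θ.Space j | P.1 ∈ finiteType E j}

variable {Θ} in
theorem mixed_mem {j m : ℕ} (hm : m ≤ j) {B : E [×j]→L[ℂ] ℂ} (hB : IsSymm B)
    (hP : (fun x => B (fun _ => x)) ∈ Θ.poly j) (y : E) : mixed B m y ∈ Θ.poly m := by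
  have h := Θ.dhat_mem m j hm y ⟨_, hP⟩
  have h0 : (j.descFactorial m : ℂ) ≠ 0 := by
    rw [Nat.cast_ne_zero, Ne, Nat.descFactorial_eq_zero_iff_lt]; omega
  have h' := Submodule.smul_mem _ (j.descFactorial m : ℂ)⁻¹ h
  rwa [dhat_diag_eq_mixed hm hB, inv_smul_smul₀ h0] at h'

/-- The function `y ↦ T(B(·, …, ·, y, …, y))`, with `m` entries `·` and `j - m` entries `y`. -/
def applyMixed {k : ℝ≥0∞} (T : StrongDual ℂ (Θ.Exp k)) {j m : ℕ} (hm : m ≤ j)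
    {B : E [×j]→L[ℂ] ℂ} (hB : IsSymm B) (hP : (fun x => B (fun _ => x)) ∈ Θ.poly j) : E → ℂ :=
  fun y => T (.mk (mixed B m y) (poly_le_expSubmodule m (mixed_mem hm hB hP y)))

/-- `Θ` is a `π_{2,k}`-holomorphy type. -/
structure IsPiTwo (k : ℝ≥0∞) : Prop where
  mem : ∀ (T : StrongDual ℂ (Θ.Exp k)) (j m : ℕ) (hm : m ≤ j) (B : E [×j]→L[ℂ] ℂ)
    (hB : IsSymm B) (hP : (fun x => B (fun _ => x)) ∈ Θ.poly j),
    Θ.applyMixed T hm hB hP ∈ Θ.poly (j - m)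
  bound : ∀ (T : StrongDual ℂ (Θ.Exp k)) (C : ℝ) (ρ : {ρ : ℝ // 0 < ρ}), 0 < C →
    (∀ f, ‖T f‖ ≤ C * Θ.expNorm k ρ f) →
    ∃ M : ℝ, 0 < M ∧ ∀ (j m : ℕ) (hm : m ≤ j) (B : E [×j]→L[ℂ] ℂ)
      (hB : IsSymm B) (hP : (fun x => B (fun _ => x)) ∈ Θ.poly j),
      Θ.nrm (j - m) ⟨Θ.applyMixed T hm hB hP, mem T j m hm B hB hP⟩
        ≤ C * M ^ j * ((ρ : ℝ) ^ m)⁻¹ * weight k m * Θ.nrm j ⟨fun x => B (fun _ => x), hP⟩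

/-! ### The Borel transform and the dual sequence `Θ'` -/

variable {Θ}

/-- The element `φ^j` of the `j`-th space. -/
def powElem (h : Θ.IsPiOne) (φ : StrongDual ℂ E) (j : ℕ) : Θ.Space j :=
  ⟨fun x => φ x ^ j, h.finiteType_le j (pow_mem_finiteType φ j)⟩

/-- The Borel transform `T ↦ (φ ↦ T(φ^j))`. -/
def borel (h : Θ.IsPiOne) (j : ℕ) : StrongDual ℂ (Θ.Space j) →ₗ[ℂ] (StrongDual ℂ E → ℂ) where
  toFun T := fun φ => T (powElem h φ j)
  map_add' _ _ := rfl
  map_smul' _ _ := rfl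

theorem borel_injective (h : Θ.IsPiOne) (j : ℕ) : Function.Injective (borel h j) := by
  rw [← LinearMap.ker_eq_bot, LinearMap.ker_eq_bot']
  intro T hT
  have hfin : ∀ P ∈ finiteType E j, ∀ hP : P ∈ Θ.poly j, T (⟨P, hP⟩ : Θ.Space j) = 0 := by
    intro P hP
    unfold finiteType at hP
    refine Submodule.span_induction
      (p := fun P _ => ∀ hP : P ∈ Θ.poly j, T (⟨P, hP⟩ : Θ.Space j) = 0) ?_ ?_ ?_ ?_ hP
    · rintro _ ⟨φ, rfl⟩ _
      exact congrFun hT φ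
    · intro _
      exact map_zero T
    · intro P Q hP hQ h1 h2 _
      change P ∈ finiteType E j at hP
      change Q ∈ finiteType E j at hQ
      have hP' := h.finiteType_le j hP
      have hQ' := h.finiteType_le j hQ
      have := map_add T (⟨P, hP'⟩ : Θ.Space j) (⟨Q, hQ'⟩ : Θ.Space j)
      exact this.trans ((congrArg₂ (· + ·) (h1 hP') (h2 hQ')).trans (add_zero 0))
    · intro c P hP h1 _
      change P ∈ finiteType E j at hP
      have hP' := h.finiteType_le j hP
      have := map_smul T c (⟨P, hP'⟩ : Θ.Space j)
      exact this.trans ((congrArg (c • ·) (h1 hP')).trans (smul_zero c))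
  have : (T : Θ.Space j → ℂ) = fun _ => 0 :=
    Continuous.ext_on (h.dense j) T.continuous continuous_const fun P hP => hfin P.1 hP P.2
  exact ContinuousLinearMap.ext fun P => congrFun this P

/-- The sequence `Θ'` on the dual of `E`: its `j`-th space is the range of the Borel transform on
the dual of the `j`-th space of `Θ`, with the norm that makes the Borel transform isometric. -/
def dual (h : Θ.IsPiOne) : PolySpaces (StrongDual ℂ E) where
  poly j := LinearMap.range (borel h j)
  nrm j := (normSeminorm ℂ (StrongDual ℂ (Θ.Space j))).comp
    (LinearEquiv.ofInjective (borel h j) (borel_injective h j)).symm.toLinearMap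
  eq_zero_of_nrm j P hP := by
    have := norm_eq_zero.1 (show
      ‖(LinearEquiv.ofInjective (borel h j) (borel_injective h j)).symm P‖ = 0 from hP)
    simpa using this

/-! ### Convolution -/

theorem weight_zero (k : ℝ≥0∞) : weight k 0 = 1 := by simp [weight]

theorem nrm_taylor_zero (f : Θ.regular) : Θ.nrm 0 (Θ.taylor 0 f) = ‖f.1 0‖ := by
  rw [← Θ.nrm_const (f.1 0)]
  congr 1
  apply Subtype.ext
  funext x
  change ((Nat.factorial 0 : ℂ)⁻¹ • dhat 0 f.1 0) x = _
  simp [dhat]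

theorem norm_apply_zero_le {k : ℝ≥0∞} (ρ : {ρ : ℝ // 0 < ρ}) (f : Θ.Exp k) :
    ‖f.toFun 0‖ ≤ Θ.expNorm k ρ f := by
  have h := (f.summable_term ρ).le_tsum 0 fun j _ => PolySpaces.term_nonneg k ρ.2 j f.reg
  have h0 : Θ.term k ρ 0 f.reg = ‖f.toFun 0‖ := by
    unfold PolySpaces.term
    rw [nrm_taylor_zero, weight_zero]
    simp [PolySpaces.Exp.reg]
  rw [h0] at h
  exact h

variable (Θ) in
/-- The evaluation `δ(f) = f(0)`. -/
def delta (k : ℝ≥0∞) : StrongDual ℂ (Θ.Exp k) where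
  toFun f := f.toFun 0
  map_add' _ _ := rfl
  map_smul' _ _ := rfl
  cont := by
    let l : Θ.Exp k →ₗ[ℂ] ℂ :=
      { toFun := fun f => f.toFun 0, map_add' := fun _ _ => rfl, map_smul' := fun _ _ => rfl }
    refine WithSeminorms.continuous_normedSpace_rng ℂ PolySpaces.withSeminorms_expNorm l
      ⟨{⟨1, one_pos⟩}, 1, fun f => ?_⟩
    rw [Finset.sup_singleton, one_smul]
    exact norm_apply_zero_le ⟨1, one_pos⟩ f

variable (Θ) in
/-- The convolution products `(T ∗ f)(x) = T(τ_{-x} f)`, where `τ_{-x} f(y) = f(y + x)`, are well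
defined, and `f ↦ T ∗ f` is a continuous operator on `Exp^k`. -/
structure ConvWellDefined (k : ℝ≥0∞) : Prop where
  translate_mem : ∀ (f : Θ.Exp k) (x : E), (fun y => f.toFun (y + x)) ∈ Θ.expSubmodule k
  conv_mem : ∀ (T : StrongDual ℂ (Θ.Exp k)) (f : Θ.Exp k),
    (fun x => T (.mk _ (translate_mem f x))) ∈ Θ.expSubmodule k
  conv_continuous : ∀ T : StrongDual ℂ (Θ.Exp k),
    Continuous fun f : Θ.Exp k => PolySpaces.Exp.mk _ (conv_mem T f)

namespace ConvWellDefined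

variable {k : ℝ≥0∞} (W : Θ.ConvWellDefined k)

/-- The translate `τ_{-x} f`, that is, `y ↦ f(y + x)`. -/
def translate (x : E) (f : Θ.Exp k) : Θ.Exp k := .mk _ (W.translate_mem f x)

/-- The operator `f ↦ T ∗ f`. -/
def convOp (T : StrongDual ℂ (Θ.Exp k)) : Θ.Exp k →L[ℂ] Θ.Exp k where
  toFun f := .mk (fun x => T (W.translate x f)) (W.conv_mem T f)
  map_add' f g := PolySpaces.Exp.ext fun x => map_add T (W.translate x f) (W.translate x g)
  map_smul' c f := PolySpaces.Exp.ext fun x => map_smul T c (W.translate x f)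
  cont := W.conv_continuous T

theorem convOp_apply (T : StrongDual ℂ (Θ.Exp k)) (f : Θ.Exp k) (x : E) :
    (W.convOp T f).toFun x = T (W.translate x f) := rfl

/-- The convolution product of functionals: `(T₁ ∗ T₂)(f) = (T₁ ∗ (T₂ ∗ f))(0)`. -/
def conv (T₁ T₂ : StrongDual ℂ (Θ.Exp k)) : StrongDual ℂ (Θ.Exp k) :=
  (Θ.delta k).comp ((W.convOp T₁).comp (W.convOp T₂))

theorem translate_zero (f : Θ.Exp k) : W.translate 0 f = f :=
  PolySpaces.Exp.ext fun y => congrArg f.toFun (add_zero y)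

theorem conv_apply (T₁ T₂ : StrongDual ℂ (Θ.Exp k)) (f : Θ.Exp k) :
    W.conv T₁ T₂ f = T₁ (W.convOp T₂ f) := congrArg T₁ (W.translate_zero _)

theorem convOp_translate (T : StrongDual ℂ (Θ.Exp k)) (x : E) (f : Θ.Exp k) :
    W.convOp T (W.translate x f) = W.translate x (W.convOp T f) :=
  PolySpaces.Exp.ext fun y => congrArg T <| PolySpaces.Exp.ext fun z =>
    congrArg f.toFun (add_assoc z y x)

theorem convOp_conv (T₁ T₂ : StrongDual ℂ (Θ.Exp k)) (f : Θ.Exp k) :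
    W.convOp (W.conv T₁ T₂) f = W.convOp T₁ (W.convOp T₂ f) :=
  PolySpaces.Exp.ext fun x => by
    rw [convOp_apply, conv_apply, convOp_translate, convOp_apply]

theorem convOp_delta (f : Θ.Exp k) : W.convOp (Θ.delta k) f = f :=
  PolySpaces.Exp.ext fun x => congrArg f.toFun (zero_add x)

/-- The dual of `Exp^k` as an algebra, with the convolution product and the unit `δ`. -/
def Alg (_W : Θ.ConvWellDefined k) : Type _ := StrongDual ℂ (Θ.Exp k)

/-- An element of the convolution algebra, as a functional. -/
def Alg.toDual {W : Θ.ConvWellDefined k} (T : W.Alg) : StrongDual ℂ (Θ.Exp k) := T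

instance : AddCommGroup W.Alg := inferInstanceAs (AddCommGroup (StrongDual ℂ (Θ.Exp k)))
instance : Module ℂ W.Alg := inferInstanceAs (Module ℂ (StrongDual ℂ (Θ.Exp k)))
instance : Mul W.Alg := ⟨fun T₁ T₂ => W.conv T₁ T₂⟩
instance : One W.Alg := ⟨Θ.delta k⟩

theorem Alg.mul_apply (T₁ T₂ : W.Alg) (f : Θ.Exp k) :
    (T₁ * T₂).toDual f = T₁.toDual (W.convOp T₂.toDual f) := W.conv_apply _ _ f

theorem Alg.ext {T₁ T₂ : W.Alg} (h : ∀ f, T₁.toDual f = T₂.toDual f) : T₁ = T₂ :=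
  ContinuousLinearMap.ext h

theorem convOp_add (T₁ T₂ : StrongDual ℂ (Θ.Exp k)) (f : Θ.Exp k) :
    W.convOp (T₁ + T₂) f = W.convOp T₁ f + W.convOp T₂ f := rfl

theorem convOp_smul (c : ℂ) (T : StrongDual ℂ (Θ.Exp k)) (f : Θ.Exp k) :
    W.convOp (c • T) f = c • W.convOp T f := rfl

instance : Ring W.Alg :=
  { (inferInstance : AddCommGroup W.Alg), (inferInstance : Mul W.Alg),
    (inferInstance : One W.Alg) with
    left_distrib := fun T₁ T₂ T₃ => Alg.ext W fun f => by
      rw [Alg.mul_apply]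
      change T₁.toDual (W.convOp (T₂.toDual + T₃.toDual) f) =
        (T₁ * T₂).toDual f + (T₁ * T₃).toDual f
      rw [convOp_add, map_add, Alg.mul_apply, Alg.mul_apply]
    right_distrib := fun T₁ T₂ T₃ => Alg.ext W fun f => by
      change _ = (T₁ * T₃).toDual f + (T₂ * T₃).toDual f
      rw [Alg.mul_apply, Alg.mul_apply, Alg.mul_apply]
      rfl
    zero_mul := fun T => Alg.ext W fun f => by
      rw [Alg.mul_apply]
      rfl
    mul_zero := fun T => Alg.ext W fun f => by
      rw [Alg.mul_apply]
      exact map_zero T.toDual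
    mul_assoc := fun T₁ T₂ T₃ => Alg.ext W fun f => by
      rw [Alg.mul_apply, Alg.mul_apply, Alg.mul_apply]
      exact congrArg T₁.toDual (W.convOp_conv T₂ T₃ f).symm
    one_mul := fun T => Alg.ext W fun f => by
      rw [Alg.mul_apply]
      exact congrArg T.toDual (W.translate_zero f)
    mul_one := fun T => Alg.ext W fun f => by
      rw [Alg.mul_apply]
      exact congrArg T.toDual (W.convOp_delta f)
    zsmul := fun n T => n • T
    zsmul_zero' := fun T => zero_zsmul T
    zsmul_succ' := fun n T => SubNegMonoid.zsmul_succ' n T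
    zsmul_neg' := fun n T => SubNegMonoid.zsmul_neg' n T
    neg_add_cancel := fun T => neg_add_cancel T }

instance : Algebra ℂ W.Alg :=
  Algebra.ofModule
    (fun c T₁ T₂ => Alg.ext W fun f => by
      rw [Alg.mul_apply]
      change _ = c • (T₁ * T₂).toDual f
      rw [Alg.mul_apply]
      rfl)
    (fun c T₁ T₂ => Alg.ext W fun f => by
      rw [Alg.mul_apply]
      change T₁.toDual (W.convOp (c • T₂.toDual) f) = c • (T₁ * T₂).toDual f
      rw [convOp_smul, map_smul, Alg.mul_apply])

end ConvWellDefined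

end HolomorphyType

end FourierBorel
end

/-! Everything is read off from Taylor coefficients at 0. The Taylor series of an element of `Exp`
converges in its topology, so a continuous functional T is determined by its restrictions Tₙ to the
n-homogeneous polynomials. Domination of T by a single norm gives ‖Tₙ‖ ≤ C ρ⁻ⁿ weight k n, and
conversely any sequence of functionals with such a bound sums to a continuous functional. Since e^φ
has the coefficients φⁿ/n!, which decay fast enough exactly because k > 1 leaves a positive power of
1/n!, the n-th derivative at 0 of the transform of T is the Borel transform of Tₙ
(`fourierBorel_entire`). For conjugate exponents weight k n · weight k' n is n! up to geometric
factors (`exists_weight_mul_weight`), so the growth of Tₙ is the growth that defines the target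
space; this gives the range (`range_fourierBorel`). Injectivity is that of the Borel transform in
each degree.

Translates and convolutions come from the binomial expansion of each Taylor polynomial at y + x, a
double series in the degrees in y and in x. Its terms are bounded by the holomorphy type inequality
for translates, and by the π₂ condition once T has acted. The weights are supermultiplicative, so
the binomial theorem collapses the double series to one norm of f (`summable_tsum_le_of_le_choose`,
`exists_hasSum_double`).

Multiplicativity needs no estimate: e^φ is an eigenvector of every convolution operator, with the
transform as eigenvalue. The transform is thus an injective homomorphism of algebras, and its range
is automatically a subalgebra, which settles (b) as well. Polarization serves throughout to bound
symmetric multilinear maps by their diagonals. -/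

noncomputable section

open Filter Topology
open scoped ENNReal

namespace FourierBorel

/-! ### Estimates for the weights -/

/-- `(n / e)^n`. -/
def stirlingPow (n : ℕ) : ℝ := ((n : ℝ) / Real.exp 1) ^ n

theorem stirlingPow_pos (n : ℕ) : 0 < stirlingPow n := by
  unfold stirlingPow
  rcases Nat.eq_zero_or_pos n with rfl | hn
  · simp
  · positivity

theorem stirlingPow_mul_le (m n : ℕ) : stirlingPow m * stirlingPow n ≤ stirlingPow (m + n) := by
  unfold stirlingPow
  rw [pow_add]
  gcongr <;> simp

theorem stirlingPow_le_factorial (n : ℕ) : stirlingPow n ≤ n.factorial := by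
  have h := Real.pow_div_factorial_le_exp _ (Nat.cast_nonneg n) n
  rw [div_le_iff₀ (by positivity)] at h
  unfold stirlingPow
  rw [div_pow, ← Real.exp_nat_mul, mul_one, div_le_iff₀ (by positivity)]
  linarith

theorem factorial_le_stirlingPow (n : ℕ) : (n.factorial : ℝ) ≤ Real.exp 1 ^ n * stirlingPow n := by
  unfold stirlingPow
  rw [← mul_pow, mul_div_cancel₀ _ (Real.exp_pos 1).ne']
  exact_mod_cast Nat.factorial_le_pow n

/-- In this form no case distinction is left: for `k = ⊤` one has `k.toReal = 0`, hence `0⁻¹ = 0` as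
exponent, and `0 ^ 0 = 1`. -/
theorem weight_eq (k : ℝ≥0∞) (j : ℕ) : weight k j =
    stirlingPow j ^ (k.toReal)⁻¹ * ((k.toReal)⁻¹ ^ (k.toReal)⁻¹) ^ j := by
  unfold weight stirlingPow
  split_ifs with h
  · simp [h]
  · have hk : 0 ≤ (k.toReal)⁻¹ := by positivity
    have h1 : (j : ℝ) / (k.toReal * Real.exp 1) = (j / Real.exp 1) * (k.toReal)⁻¹ := by
      rw [mul_comm, ← div_div, div_eq_mul_inv _ k.toReal]
    rw [h1, div_eq_mul_inv (j : ℝ) k.toReal, Real.mul_rpow (by positivity) hk,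
      Real.rpow_mul (by positivity), Real.rpow_natCast, mul_comm (j : ℝ),
      Real.rpow_mul hk, Real.rpow_natCast]

theorem rpow_self_pos {s : ℝ} (hs : 0 ≤ s) : 0 < s ^ s := by
  rcases hs.eq_or_lt with rfl | h
  · simp
  · positivity

theorem weight_pos (k : ℝ≥0∞) (j : ℕ) : 0 < weight k j := by
  rw [weight_eq]
  have := stirlingPow_pos j
  have := rpow_self_pos (s := (k.toReal)⁻¹) (by positivity)
  positivity

/-- Inherited from mᵐ nⁿ ≤ (m + n)ᵐ⁺ⁿ. It lets the weights of the two degrees in a binomial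
expansion be absorbed into the weight of the total degree. -/
theorem weight_mul_le (k : ℝ≥0∞) (m n : ℕ) : weight k m * weight k n ≤ weight k (m + n) := by
  have h0 : 0 ≤ (k.toReal)⁻¹ := by positivity
  have hm := stirlingPow_pos m
  have hn := stirlingPow_pos n
  have := rpow_self_pos h0
  rw [weight_eq, weight_eq, weight_eq, mul_mul_mul_comm, ← pow_add,
    ← Real.mul_rpow hm.le hn.le]
  gcongr
  exact stirlingPow_mul_le m n

/-- From 1 ≤ j! ≤ eʲ (j/e)ʲ. Weighted summability for every radius thereby controls the unweighted
series, at the price of rescaling the radius. -/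
theorem exists_pow_le_weight (k : ℝ≥0∞) : ∃ d : ℝ, 0 < d ∧ ∀ j, d ^ j ≤ weight k j := by
  have h0 : 0 ≤ (k.toReal)⁻¹ := by positivity
  have h1 := rpow_self_pos h0
  refine ⟨(Real.exp 1)⁻¹ ^ (k.toReal)⁻¹ * (k.toReal)⁻¹ ^ (k.toReal)⁻¹, by positivity, fun j => ?_⟩
  rw [weight_eq, mul_pow, ← Real.rpow_natCast ((Real.exp 1)⁻¹ ^ (k.toReal)⁻¹), ← Real.rpow_mul
    (by positivity), mul_comm _ (j : ℝ), Real.rpow_mul (by positivity), Real.rpow_natCast]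
  gcongr
  have h2 := factorial_le_stirlingPow j
  have h3 : (1 : ℝ) ≤ j.factorial := by exact_mod_cast j.factorial_pos
  rw [inv_pow, inv_le_iff_one_le_mul₀ (by positivity)]
  linarith

/-- For conjugate exponents, `weight k j * weight k' j` is `j!` up to a geometric factor. -/
theorem exists_weight_mul_weight {k k' : ℝ≥0∞} (h : (k.toReal)⁻¹ + (k'.toReal)⁻¹ = 1) :
    ∃ c : ℝ, 0 < c ∧ ∀ j : ℕ, (j.factorial : ℝ) ≤ c ^ j * (weight k j * weight k' j) ∧
      weight k j * weight k' j ≤ c ^ j * j.factorial := by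
  set s := (k.toReal)⁻¹ with hs
  set t := (k'.toReal)⁻¹ with ht
  have hs0 : 0 ≤ s := by positivity
  have ht0 : 0 ≤ t := by positivity
  set γ : ℝ := s ^ s * t ^ t with hγ
  have hγ0 : 0 < γ := mul_pos (rpow_self_pos hs0) (rpow_self_pos ht0)
  -- As s + t = 1, the two fractional powers of (j/e)ʲ recombine to (j/e)ʲ, which lies between e⁻ʲ
  -- j! and j!.
  have key : ∀ j, weight k j * weight k' j = stirlingPow j * γ ^ j := fun j => by
    rw [weight_eq, weight_eq, mul_mul_mul_comm, ← Real.rpow_add (stirlingPow_pos j), ← hs, ← ht, h,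
      Real.rpow_one, ← mul_pow]
  refine ⟨max (Real.exp 1 / γ) γ, lt_max_of_lt_right hγ0, fun j => ?_⟩
  have hj := stirlingPow_pos j
  rw [key]
  constructor
  · refine (factorial_le_stirlingPow j).trans ?_
    calc Real.exp 1 ^ j * stirlingPow j = (Real.exp 1 / γ) ^ j * (stirlingPow j * γ ^ j) := by
          rw [div_pow]; field_simp
      _ ≤ _ := by gcongr; exact le_max_left _ _
  · rw [mul_comm]
    gcongr
    · exact le_max_right _ _
    · exact stirlingPow_le_factorial j

theorem summable_pow_mul_factorial_rpow {t : ℝ} (ht : 0 < t) (R : ℝ) (hR : 0 < R) :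
    Summable fun j : ℕ => R ^ j * (j.factorial : ℝ) ^ (-t) := by
  refine summable_of_ratio_test_tendsto_lt_one (l := 0) one_pos
    (Eventually.of_forall fun j => by positivity) ?_
  have h : ∀ j : ℕ, ‖R ^ (j + 1) * ((j + 1).factorial : ℝ) ^ (-t)‖ /
      ‖R ^ j * (j.factorial : ℝ) ^ (-t)‖ = R * ((j : ℝ) + 1) ^ (-t) := fun j => by
    have h1 : 0 < (j.factorial : ℝ) ^ (-t) := by positivity
    have h2 : 0 < ((j : ℝ) + 1) ^ (-t) := by positivity
    rw [Real.norm_of_nonneg (by positivity), Real.norm_of_nonneg (by positivity),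
      Nat.factorial_succ, Nat.cast_mul, Real.mul_rpow (by positivity) (by positivity)]
    push_cast
    field_simp
    ring
  simp only [h]
  rw [← mul_zero R]
  exact ((tendsto_rpow_neg_atTop ht).comp
    (tendsto_natCast_atTop_atTop.atTop_add tendsto_const_nhds)).const_mul R

/-- Up to a geometric factor the weight is at most (j!)^(1/k), so a negative power of j! survives
when 1/k < 1, and it beats any geometric growth. This is where k > 1 enters. -/
theorem summable_weight_div_factorial {k : ℝ≥0∞} (hk : (k.toReal)⁻¹ < 1) {R : ℝ} (hR : 0 < R) :
    Summable fun j : ℕ => R ^ j * weight k j * (j.factorial : ℝ)⁻¹ := by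
  set s := (k.toReal)⁻¹ with hs
  have hs0 : 0 ≤ s := by positivity
  have hγ := rpow_self_pos hs0
  refine (summable_pow_mul_factorial_rpow (sub_pos.2 hk) (R * s ^ s) (by positivity)).of_nonneg_of_le
    (fun j => by have := weight_pos k j; positivity) fun j => ?_
  have hj : (0 : ℝ) < j.factorial := by positivity
  have hj' := stirlingPow_pos j
  have hle : stirlingPow j ^ s ≤ (j.factorial : ℝ) ^ s :=
    Real.rpow_le_rpow hj'.le (stirlingPow_le_factorial j) hs0
  rw [weight_eq, ← hs, neg_sub, Real.rpow_sub_one hj.ne', mul_pow]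
  calc _ = R ^ j * (s ^ s) ^ j * (stirlingPow j ^ s * (j.factorial : ℝ)⁻¹) := by ring
    _ ≤ R ^ j * (s ^ s) ^ j * ((j.factorial : ℝ) ^ s * (j.factorial : ℝ)⁻¹) := by gcongr
    _ = _ := by rw [div_eq_mul_inv]

/-! ### Polarization -/

section Polarization

variable {V W : Type*} {n : ℕ}

/-- The sets T that avoid the range of `r` are the subsets of its complement, and the alternating
sum over all subsets vanishes unless that complement is empty. -/
theorem sum_neg_one_pow_avoiding (r : Fin n → Fin n) :
    (∑ T : Finset (Fin n), if ∀ i, r i ∈ Tᶜ then (-1 : ℂ) ^ T.card else 0) =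
      if Function.Surjective r then 1 else 0 := by
  classical
  have h1 : (Finset.univ.filter fun T : Finset (Fin n) => ∀ i, r i ∈ Tᶜ) =
      ((Finset.univ.image r)ᶜ).powerset := by
    ext T
    simp only [Finset.mem_filter, Finset.mem_univ, true_and, Finset.mem_compl,
      Finset.mem_powerset, Finset.subset_iff, Finset.mem_image, not_exists]
    constructor
    · rintro h t ht i rfl
      exact h i ht
    · intro h i hi
      exact h hi i rfl
  rw [← Finset.sum_filter, h1]
  have h2 := congrArg (Int.cast (R := ℂ))
    (Finset.sum_powerset_neg_one_pow_card (x := (Finset.univ.image r)ᶜ))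
  push_cast at h2
  rw [h2]
  congr 1
  rw [Finset.compl_eq_empty_iff, Finset.eq_univ_iff_forall]
  simp [Function.Surjective]

theorem sum_surjective_eq_sum_perm [AddCommMonoid W] (g : (Fin n → Fin n) → W)
    [DecidablePred fun r : Fin n → Fin n => Function.Surjective r] :
    (∑ r with Function.Surjective r, g r) = ∑ σ : Equiv.Perm (Fin n), g σ := by
  refine (Finset.sum_bij (fun (σ : Equiv.Perm (Fin n)) _ => (σ : Fin n → Fin n))
    (fun σ _ => by simpa using σ.surjective) (fun σ _ τ _ h => DFunLike.coe_injective h)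
    (fun r hr => ?_) fun _ _ => rfl).symm
  have hr : Function.Surjective r := by simpa using hr
  exact ⟨Equiv.ofBijective r ⟨Finite.injective_iff_surjective.2 hr, hr⟩, by simp, rfl⟩

/-- The polarization formula. -/
theorem polarization [AddCommGroup V] [Module ℂ V] [AddCommGroup W] [Module ℂ W]
    (A : MultilinearMap ℂ (fun _ : Fin n => V) W)
    (hA : ∀ (σ : Equiv.Perm (Fin n)) (v : Fin n → V), A (fun i => v (σ i)) = A v) (x : Fin n → V) :
    ∑ T : Finset (Fin n), (-1 : ℂ) ^ T.card • A (fun _ => ∑ i ∈ Tᶜ, x i) =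
      (n.factorial : ℂ) • A x := by
  classical
  -- Multilinear expansion over all maps r with values in Tᶜ. After the sums are exchanged only
  -- surjective r survive, that is, the permutations, and each of them contributes A x by symmetry.
  have h1 : ∀ T : Finset (Fin n), (-1 : ℂ) ^ T.card • A (fun _ => ∑ i ∈ Tᶜ, x i) =
      ∑ r : Fin n → Fin n, (if ∀ i, r i ∈ Tᶜ then (-1 : ℂ) ^ T.card else 0) •
        A (fun i => x (r i)) := fun T => by
    rw [A.map_sum_finset (fun _ => x) (fun _ => Tᶜ), Finset.smul_sum]
    simp only [ite_smul, zero_smul]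
    rw [← Finset.sum_filter]
    refine Finset.sum_congr ?_ fun _ _ => rfl
    ext r
    simp
  simp only [h1]
  rw [Finset.sum_comm]
  simp only [← Finset.sum_smul, sum_neg_one_pow_avoiding]
  simp only [ite_smul, one_smul, zero_smul]
  rw [← Finset.sum_filter, sum_surjective_eq_sum_perm (fun r => A (fun i => x (r i)))]
  simp only [hA]
  rw [Finset.sum_const, Finset.card_univ, Fintype.card_perm, Fintype.card_fin, Nat.cast_smul_eq_nsmul]

/-- For vectors of norm at most 1 the polarization formula has 2ⁿ terms, each at most C nⁿ, and nⁿ ≤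
eⁿ n!; the general case follows by scaling. Continuity of `A` is not presupposed, so the bound can
be used to establish it. -/
theorem norm_multilinear_le_of_norm_diag_le [NormedAddCommGroup V] [NormedSpace ℂ V]
    [NormedAddCommGroup W] [NormedSpace ℂ W] (A : MultilinearMap ℂ (fun _ : Fin n => V) W)
    (hA : ∀ (σ : Equiv.Perm (Fin n)) (v : Fin n → V), A (fun i => v (σ i)) = A v) {C : ℝ}
    (hC0 : 0 ≤ C) (hC : ∀ x, ‖A (fun _ => x)‖ ≤ C * ‖x‖ ^ n) (x : Fin n → V) :
    ‖A x‖ ≤ C * (2 * Real.exp 1) ^ n * ∏ i, ‖x i‖ := by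
  have unit : ∀ x : Fin n → V, (∀ i, ‖x i‖ ≤ 1) → ‖A x‖ ≤ C * (2 * Real.exp 1) ^ n := by
    intro x hx
    have h1 := congrArg norm (polarization A hA x)
    rw [norm_smul, Complex.norm_natCast] at h1
    have h2 : (n.factorial : ℝ) * ‖A x‖ ≤ 2 ^ n * (C * (n : ℝ) ^ n) := by
      rw [← h1]
      refine (norm_sum_le _ _).trans ?_
      have h3 : ∀ T : Finset (Fin n), ‖(-1 : ℂ) ^ T.card • A (fun _ => ∑ i ∈ Tᶜ, x i)‖ ≤
          C * (n : ℝ) ^ n := fun T => by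
        rw [norm_smul, norm_pow, norm_neg, norm_one, one_pow, one_mul]
        refine (hC _).trans ?_
        gcongr
        refine (norm_sum_le _ _).trans ((Finset.sum_le_sum fun i _ => hx i).trans ?_)
        rw [Finset.sum_const, nsmul_eq_mul, mul_one]
        exact_mod_cast (Finset.card_le_univ _).trans (Fintype.card_fin n).le
      refine (Finset.sum_le_sum fun T _ => h3 T).trans ?_
      simp
    have h4 := Real.pow_div_factorial_le_exp _ (Nat.cast_nonneg n) n
    have hn : (0 : ℝ) < n.factorial := by positivity
    rw [← mul_one (n : ℝ), Real.exp_nat_mul, mul_one, div_le_iff₀ hn] at h4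
    refine le_of_mul_le_mul_left (h2.trans ?_) hn
    calc (2 : ℝ) ^ n * (C * (n : ℝ) ^ n) ≤ 2 ^ n * (C * (Real.exp 1 ^ n * n.factorial)) := by gcongr
      _ = _ := by rw [mul_pow]; ring
  -- A zero entry causes no trouble: the inverse of its norm is 0, and both sides vanish.
  have hx : x = fun i => ((‖x i‖ : ℝ) : ℂ) • (((‖x i‖⁻¹ : ℝ) : ℂ) • x i) := by
    funext i
    rcases eq_or_ne (x i) 0 with h | h
    · simp [h]
    · rw [smul_smul, ← Complex.ofReal_mul, mul_inv_cancel₀ (norm_ne_zero_iff.2 h),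
        Complex.ofReal_one, one_smul]
  have h5 := unit (fun i => ((‖x i‖⁻¹ : ℝ) : ℂ) • x i) fun i => by
    rw [norm_smul, Complex.norm_real, norm_inv, norm_norm]
    exact inv_mul_le_one
  rw [hx, A.map_smul_univ, norm_smul, norm_prod, ← hx, mul_comm]
  simp only [Complex.norm_real, norm_norm]
  gcongr

end Polarization

/-! ### Power series of homogeneous polynomials -/

section Series

variable {X : Type*} [NormedAddCommGroup X] [NormedSpace ℂ X]

/-- The j-th derivative at 0 divided by j! is symmetric, being a derivative, and restricts to P on
the diagonal. -/
theorem IsHomogPoly.exists_isSymm {j : ℕ} {P : X → ℂ} (hP : IsHomogPoly j P) :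
    ∃ B : X [×j]→L[ℂ] ℂ, IsSymm B ∧ P = fun x => B (fun _ => x) := by
  refine ⟨(j.factorial : ℂ)⁻¹ • iteratedFDeriv ℂ j P 0, fun s v => ?_, ?_⟩
  · simp only [smul_apply]
    congr 1
    exact (hP.entire 0 (Set.mem_univ _)).contDiffAt.iteratedFDeriv_comp_perm v s
  · have h := hP.dhat_zero_self
    have hj : (j.factorial : ℂ) ≠ 0 := by exact_mod_cast j.factorial_ne_zero
    rw [← inv_smul_eq_iff₀ hj] at h
    exact h.symm

theorem IsSymm.norm_le {j : ℕ} {B : X [×j]→L[ℂ] ℂ} (hB : IsSymm B) {C : ℝ} (hC0 : 0 ≤ C)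
    (hC : ∀ x, ‖B (fun _ => x)‖ ≤ C * ‖x‖ ^ j) : ‖B‖ ≤ C * (2 * Real.exp 1) ^ j :=
  B.opNorm_le_bound (by positivity)
    (norm_multilinear_le_of_norm_diag_le B.toMultilinearMap hB hC0 hC)

/-- An everywhere convergent series of homogeneous polynomials is entire, and its terms are the
Taylor polynomials of the sum. -/
theorem entire_of_hasSum {p : ℕ → X → ℂ} (hp : ∀ n, IsHomogPoly n (p n)) {b : ℕ → ℝ}
    (hb0 : ∀ n, 0 ≤ b n) (hb : ∀ n x, ‖p n x‖ ≤ b n * ‖x‖ ^ n)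
    (hs : ∀ R : ℝ, 0 < R → Summable fun n => b n * R ^ n) {f : X → ℂ}
    (hf : ∀ x, HasSum (fun n => p n x) (f x)) :
    Entire f ∧ ∀ n, dhat n f 0 = (n.factorial : ℂ) • p n := by
  choose B hB hpB using fun n => (hp n).exists_isSymm
  -- Polarization costs a factor (2e)ⁿ, harmless because `hs` holds for every radius.
  have hnorm : ∀ n, ‖B n‖ ≤ b n * (2 * Real.exp 1) ^ n := fun n =>
    (hB n).norm_le (hb0 n) fun x => by
      have := hb n x
      rwa [hpB n] at this
  have hrad : FormalMultilinearSeries.radius B = ⊤ := by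
    refine FormalMultilinearSeries.radius_eq_top_of_summable_norm B fun r => ?_
    refine (hs (2 * Real.exp 1 * (r + 1)) (by positivity)).of_nonneg_of_le
      (fun n => by positivity) fun n => ?_
    calc ‖B n‖ * (r : ℝ) ^ n ≤ b n * (2 * Real.exp 1) ^ n * ((r : ℝ) + 1) ^ n := by
          have := hb0 n
          gcongr
          · exact hnorm n
          · linarith
      _ = _ := by rw [mul_pow (2 * Real.exp 1)]; ring
  have hfB : HasFPowerSeriesOnBall f B 0 ⊤ :=
    ⟨by rw [hrad], by simp, fun {y} _ => by
      rw [zero_add]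
      have := hf y
      simpa only [hpB] using this⟩
  refine ⟨fun a _ => hfB.analyticAt_of_mem (by simp), fun n => funext fun x => ?_⟩
  have := hfB.factorial_smul x n
  rw [dhat, ← this, Pi.smul_apply, Nat.cast_smul_eq_nsmul, hpB n]

/-- Analyticity gives only local power series. Restriction to complex lines through 0 makes the
one-variable theorem on entire functions available, and with it convergence everywhere. -/
theorem Entire.iteratedDeriv_line {f : X → ℂ} (hf : Entire f) (x : X) (n : ℕ) :
    iteratedDeriv n (fun z : ℂ => f (z • x)) 0 = dhat n f 0 x := by
  have hc : ContDiff ℂ n f := contDiff_iff_contDiffAt.2 fun a => hf.contDiffAt a n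
  have h := ContinuousLinearMap.iteratedFDeriv_comp_right
    (ContinuousLinearMap.toSpanSingleton ℂ x) hc (0 : ℂ) (i := n) le_rfl
  rw [iteratedDeriv_eq_iteratedFDeriv, dhat]
  have h2 : (fun z : ℂ => f (z • x)) = f ∘ (ContinuousLinearMap.toSpanSingleton ℂ x) := by
    funext z; simp
  rw [h2, h]
  simp

/-- An entire function is everywhere the sum of its Taylor series at `0`. -/
theorem Entire.hasSum {f : X → ℂ} (hf : Entire f) (x : X) :
    HasSum (fun n => (n.factorial : ℂ)⁻¹ * dhat n f 0 x) (f x) := by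
  have hd : Differentiable ℂ fun z : ℂ => f (z • x) := fun z =>
    ((hf (z • x) (Set.mem_univ _)).differentiableAt).comp z
      (differentiableAt_id.smul_const x)
  have := Complex.hasSum_taylorSeries_of_entire hd 0 1
  simpa [hf.iteratedDeriv_line] using this

/-- The binomial formula for symmetric multilinear maps. -/
theorem IsSymm.apply_add {j : ℕ} {B : X [×j]→L[ℂ] ℂ} (hB : IsSymm B) (x y : X) :
    B (fun _ => y + x) = ∑ m ∈ Finset.range (j + 1), (j.choose m : ℂ) * mixed B m x y := by
  classical
  -- By symmetry only the number of entries y matters: a permutation moves `S` to the initial block.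
  have key : ∀ S : Finset (Fin j), B (S.piecewise (fun _ => y) (fun _ => x)) =
      mixed B S.card x y := by
    intro S
    have hc : S.card ≤ j := by simpa using Finset.card_le_univ S
    obtain ⟨s, hs⟩ := Equiv.Perm.exists_extending_pair (Fin.castLEEmb hc)
      (fun a : Fin S.card => (S.equivFin.symm a : Fin j))
      (Fin.castLEEmb hc).injective (Subtype.val_injective.comp S.equivFin.symm.injective)
    rw [mixed, ← hB s]
    congr 1
    funext i
    have : s i ∈ S ↔ (i : ℕ) < S.card := by
      constructor
      · intro hi
        have h1 := hs (S.equivFin ⟨s i, hi⟩)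
        simp only [Equiv.symm_apply_apply] at h1
        rw [← s.injective h1]
        exact (S.equivFin ⟨s i, hi⟩).2
      · intro hi
        have h1 := hs ⟨i, hi⟩
        have h2 : (Fin.castLEEmb hc) ⟨i, hi⟩ = i := rfl
        rw [h2] at h1
        rw [h1]
        exact (S.equivFin.symm ⟨i, hi⟩).2
    simp [Finset.piecewise, this]
  have h := B.map_add_univ (fun _ => y) (fun _ => x)
  have h0 : ((fun _ => y) + fun _ => x : Fin j → X) = fun _ => y + x := rfl
  rw [h0] at h
  rw [h]
  simp only [key]
  have h2 := Finset.sum_powerset_apply_card (fun m => mixed B m x y)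
    (x := (Finset.univ : Finset (Fin j)))
  rw [Finset.powerset_univ] at h2
  rw [h2, Finset.card_univ, Fintype.card_fin]
  simp only [nsmul_eq_mul]

end Series

/-! ### Double series indexed by the antidiagonals -/

theorem hasSum_sum_antidiagonal {f : ℕ × ℕ → ℂ} {a : ℂ} (h : HasSum f a) :
    HasSum (fun j => ∑ p ∈ Finset.HasAntidiagonal.antidiagonal j, f p) a :=
  (Finset.HasAntidiagonal.sigmaAntidiagonalEquivProd.hasSum_iff.2 h).sigma fun j => by
    rw [← Finset.sum_attach]
    exact hasSum_fintype _

/-- By the binomial theorem the antidiagonal of index j sums to at most (a + b)ʲ c j. The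
translation and convolution estimates both end here. -/
theorem summable_tsum_le_of_le_choose {f : ℕ × ℕ → ℝ} (hf0 : ∀ p, 0 ≤ f p) {a b : ℝ} {c : ℕ → ℝ}
    (hf : ∀ m n, f (m, n) ≤ ((m + n).choose m : ℝ) * a ^ m * b ^ n * c (m + n))
    (hs : Summable fun j => (a + b) ^ j * c j) :
    Summable f ∧ ∑' p, f p ≤ ∑' j, (a + b) ^ j * c j := by
  have hle : ∀ j, ∑ p ∈ Finset.HasAntidiagonal.antidiagonal j, f p ≤ (a + b) ^ j * c j := fun j => by
    rw [(Commute.all a b).add_pow', Finset.sum_mul]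
    refine Finset.sum_le_sum fun p hp => ?_
    obtain ⟨m, n⟩ := p
    obtain rfl := Finset.HasAntidiagonal.mem_antidiagonal.1 hp
    refine (hf m n).trans_eq ?_
    rw [nsmul_eq_mul]
    ring
  have hfib : ∀ j, ∑' p : Finset.HasAntidiagonal.antidiagonal j, f p = ∑ p ∈ Finset.HasAntidiagonal.antidiagonal j, f p :=
    fun j => by rw [tsum_fintype, Finset.sum_coe_sort]
  have hs' : Summable fun j => ∑ p ∈ Finset.HasAntidiagonal.antidiagonal j, f p :=
    hs.of_nonneg_of_le (fun j => Finset.sum_nonneg fun p _ => hf0 p) hle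
  have hsig : Summable fun q => f (Finset.HasAntidiagonal.sigmaAntidiagonalEquivProd q) := by
    refine (summable_sigma_of_nonneg fun p => hf0 _).2 ⟨fun j => Summable.of_finite, ?_⟩
    refine hs'.congr fun j => ?_
    exact (hfib j).symm
  refine ⟨Finset.HasAntidiagonal.sigmaAntidiagonalEquivProd.summable_iff.1 hsig, ?_⟩
  rw [← Finset.HasAntidiagonal.sigmaAntidiagonalEquivProd.tsum_eq, Summable.tsum_sigma' (fun _ => .of_finite) hsig]
  refine Summable.tsum_le_tsum (fun j => ?_) ?_ hs
  · exact (hfib j).trans_le (hle j)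
  · exact hs'.congr fun j => (hfib j).symm

namespace HolomorphyType

variable {E : Type*} [NormedAddCommGroup E] [NormedSpace ℂ E] {Θ : HolomorphyType E} {k : ℝ≥0∞}

/-! ### The spaces of polynomials -/

theorem nrm_congr {i j : ℕ} (h : i = j) {P : E → ℂ} (hi : P ∈ Θ.poly i) (hj : P ∈ Θ.poly j) :
    Θ.nrm i ⟨P, hi⟩ = Θ.nrm j ⟨P, hj⟩ := by
  subst h; rfl

variable (Θ) in
-- The case m = 0 of the holomorphy type inequality, as the norm in degree 0 is the modulus.
theorem exists_norm_apply_le : ∃ σ : ℝ, 1 ≤ σ ∧ ∀ (j : ℕ) (P : Θ.Space j) (x : E),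
    ‖P.1 x‖ ≤ σ ^ j * ‖P‖ * ‖x‖ ^ j := by
  obtain ⟨σ, hσ, h⟩ := Θ.exists_nrm_dhat_le
  refine ⟨σ, hσ, fun j P x => ?_⟩
  have h1 := h 0 j (Nat.zero_le j) x P
  rw [Nat.sub_zero] at h1
  refine le_trans (le_of_eq ?_) h1
  rw [← Θ.nrm_const (P.1 x)]
  congr 1
  apply Subtype.ext
  funext y
  change _ = ((Nat.factorial 0 : ℂ)⁻¹ • dhat 0 P.1 x) y
  simp [dhat]

/-- A symmetric multilinear form that induces the polynomial `P`. -/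
def symForm {j : ℕ} (P : Θ.Space j) : E [×j]→L[ℂ] ℂ :=
  (Θ.isHomogPoly j P.1 P.2).exists_isSymm.choose

theorem symForm_isSymm {j : ℕ} (P : Θ.Space j) : IsSymm (symForm P) :=
  (Θ.isHomogPoly j P.1 P.2).exists_isSymm.choose_spec.1

theorem eq_symForm {j : ℕ} (P : Θ.Space j) : P.1 = fun x => symForm P (fun _ => x) :=
  (Θ.isHomogPoly j P.1 P.2).exists_isSymm.choose_spec.2

theorem symForm_mem {j : ℕ} (P : Θ.Space j) : (fun x => symForm P (fun _ => x)) ∈ Θ.poly j :=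
  eq_symForm P ▸ P.2

theorem nrm_symForm {j : ℕ} (P : Θ.Space j) :
    Θ.nrm j ⟨fun x => symForm P (fun _ => x), symForm_mem P⟩ = ‖P‖ := by
  change _ = Θ.nrm j P
  congr 1
  exact Subtype.ext (eq_symForm P).symm

variable (k) in
/-- The inclusion of the `j`-th space of polynomials into `Exp`. -/
def ofPoly (j : ℕ) : Θ.Space j →ₗ[ℂ] Θ.Exp k where
  toFun P := .mk P.1 (poly_le_expSubmodule j P.2)
  map_add' _ _ := rfl
  map_smul' _ _ := rfl

/-- The `n`-th Taylor polynomial at `0`. -/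
def coeff (n : ℕ) : Θ.Exp k →ₗ[ℂ] Θ.Space n where
  toFun f := Θ.taylor n f.reg
  map_add' f g := (Θ.taylor n).map_add f.reg g.reg
  map_smul' c f := (Θ.taylor n).map_smul c f.reg

theorem coeff_apply (n : ℕ) (f : Θ.Exp k) (x : E) :
    (coeff n f).1 x = (n.factorial : ℂ)⁻¹ * dhat n f.toFun 0 x := rfl

theorem coeff_ofPoly_self {j : ℕ} (P : Θ.Space j) : coeff j (ofPoly k j P) = P := by
  apply Subtype.ext
  funext x
  rw [coeff_apply]
  change _ * dhat j P.1 0 x = _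
  rw [(Θ.isHomogPoly j P.1 P.2).dhat_zero_self, Pi.smul_apply, smul_eq_mul,
    inv_mul_cancel_left₀ (by exact_mod_cast j.factorial_ne_zero)]

theorem coeff_ofPoly_of_ne {n j : ℕ} (h : n ≠ j) (P : Θ.Space j) :
    coeff n (ofPoly k j P) = 0 := by
  apply Subtype.ext
  funext x
  rw [coeff_apply]
  change _ * dhat n P.1 0 x = 0
  rw [(Θ.isHomogPoly j P.1 P.2).dhat_zero_of_ne h, Pi.zero_apply, mul_zero]

theorem expNorm_eq (ρ : {ρ : ℝ // 0 < ρ}) (f : Θ.Exp k) :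
    Θ.expNorm k ρ f = ∑' n, ((ρ : ℝ) ^ n)⁻¹ * weight k n * ‖coeff n f‖ := rfl

theorem summable_coeff (f : Θ.Exp k) {R : ℝ} (hR : 0 < R) :
    Summable fun n => R ^ n * weight k n * ‖coeff n f‖ := by
  have := f.summable_term ⟨R⁻¹, inv_pos.2 hR⟩
  refine this.congr fun n => ?_
  change ((R⁻¹) ^ n)⁻¹ * weight k n * ‖coeff n f‖ = _
  rw [inv_pow, inv_inv]

theorem summable_expNorm (ρ : {ρ : ℝ // 0 < ρ}) (f : Θ.Exp k) :
    Summable fun n => ((ρ : ℝ) ^ n)⁻¹ * weight k n * ‖coeff n f‖ := f.summable_term ρ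

theorem expNorm_ofPoly (ρ : {ρ : ℝ // 0 < ρ}) {j : ℕ} (P : Θ.Space j) :
    Θ.expNorm k ρ (ofPoly k j P) = ((ρ : ℝ) ^ j)⁻¹ * weight k j * ‖P‖ := by
  rw [expNorm_eq, tsum_eq_single j fun n hn => by rw [coeff_ofPoly_of_ne hn, norm_zero, mul_zero],
    coeff_ofPoly_self]

theorem hasSum_coeff_apply (f : Θ.Exp k) (x : E) :
    HasSum (fun n => (coeff n f).1 x) (f.toFun x) := f.mem_regular.1.hasSum x

theorem expNorm_le_of_le {ρ τ : {ρ : ℝ // 0 < ρ}} (h : ρ ≤ τ) :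
    Θ.expNorm k τ ≤ Θ.expNorm k ρ := fun f => by
  rw [expNorm_eq, expNorm_eq]
  refine (summable_expNorm τ f).tsum_le_tsum (fun n => ?_) (summable_expNorm ρ f)
  have := weight_nonneg k n
  have := ρ.2
  have h' : (ρ : ℝ) ≤ τ := h
  gcongr

theorem exists_finset_sup_expNorm_le (s : Finset {ρ : ℝ // 0 < ρ}) :
    ∃ ρ, s.sup (Θ.expNorm k) ≤ Θ.expNorm k ρ := by
  classical
  induction s using Finset.induction_on with
  | empty => exact ⟨⟨1, one_pos⟩, by simp⟩
  | insert τ s _ ih =>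
    obtain ⟨ρ, hρ⟩ := ih
    refine ⟨min τ ρ, ?_⟩
    rw [Finset.sup_insert]
    exact sup_le (expNorm_le_of_le (min_le_left _ _))
      (hρ.trans (expNorm_le_of_le (min_le_right _ _)))

/-- The norms decrease in ρ, so a finite supremum of them is dominated by a single one. This is the
form of continuity that the π₂ condition takes as input. -/
theorem exists_norm_le_expNorm (T : StrongDual ℂ (Θ.Exp k)) :
    ∃ (C : ℝ) (ρ : {ρ : ℝ // 0 < ρ}), 0 < C ∧ ∀ f, ‖T f‖ ≤ C * Θ.expNorm k ρ f := by
  obtain ⟨s, C, hC, h⟩ := Seminorm.bound_of_continuous PolySpaces.withSeminorms_expNorm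
    ((normSeminorm ℂ ℂ).comp T.toLinearMap) T.continuous.norm
  obtain ⟨ρ, hρ⟩ := exists_finset_sup_expNorm_le (Θ := Θ) (k := k) s
  refine ⟨C, ρ, by positivity, fun f => (h f).trans ?_⟩
  exact mul_le_mul_of_nonneg_left (hρ f) C.2

/-- A linear functional dominated by one of the norms is continuous. -/
def mkDual (T : Θ.Exp k →ₗ[ℂ] ℂ) (C : ℝ) (hC0 : 0 ≤ C) (ρ : {ρ : ℝ // 0 < ρ})
    (hC : ∀ f, ‖T f‖ ≤ C * Θ.expNorm k ρ f) : StrongDual ℂ (Θ.Exp k) where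
  toLinearMap := T
  cont := WithSeminorms.continuous_normedSpace_rng ℂ PolySpaces.withSeminorms_expNorm T
    ⟨{ρ}, ⟨C, hC0⟩, fun f => by
      rw [Finset.sup_singleton]
      exact hC f⟩

/-- The restriction of a functional to the `j`-th space of polynomials. -/
def restrict (T : StrongDual ℂ (Θ.Exp k)) (j : ℕ) : StrongDual ℂ (Θ.Space j) where
  toLinearMap := T.toLinearMap ∘ₗ ofPoly k j
  cont := by
    obtain ⟨C, ρ, hC0, hC⟩ := exists_norm_le_expNorm T
    refine AddMonoidHomClass.continuous_of_bound (T.toLinearMap ∘ₗ ofPoly k j)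
      (C * (((ρ : ℝ) ^ j)⁻¹ * weight k j)) fun P => ?_
    refine (hC _).trans_eq ?_
    rw [expNorm_ofPoly]
    ring

theorem restrict_apply (T : StrongDual ℂ (Θ.Exp k)) {j : ℕ} (P : Θ.Space j) :
    restrict T j P = T (ofPoly k j P) := rfl

theorem norm_restrict_le {T : StrongDual ℂ (Θ.Exp k)} {C : ℝ} (hC0 : 0 ≤ C) {ρ : {ρ : ℝ // 0 < ρ}}
    (hC : ∀ f, ‖T f‖ ≤ C * Θ.expNorm k ρ f) (j : ℕ) :
    ‖restrict T j‖ ≤ C * (((ρ : ℝ) ^ j)⁻¹ * weight k j) := by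
  have := weight_nonneg k j
  have := ρ.2
  refine ContinuousLinearMap.opNorm_le_bound _ (by positivity) fun P => ?_
  refine (hC _).trans_eq ?_
  rw [expNorm_ofPoly]
  ring

/-! ### Convergence in `Exp` -/

theorem coeff_sum_ofPoly (f : Θ.Exp k) (s : Finset ℕ) (m : ℕ) :
    coeff m (∑ n ∈ s, ofPoly k n (coeff n f)) = if m ∈ s then coeff m f else 0 := by
  rw [map_sum]
  split_ifs with h
  · rw [Finset.sum_eq_single m (fun n _ hn => coeff_ofPoly_of_ne hn.symm _)
      (fun h' => absurd h h'), coeff_ofPoly_self]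
  · exact Finset.sum_eq_zero fun n hn => coeff_ofPoly_of_ne (fun e : m = n => h (e.symm ▸ hn)) _

/-- The Taylor series at `0` converges in `Exp`. -/
theorem hasSum_ofPoly_coeff (f : Θ.Exp k) :
    HasSum (fun n => ofPoly k n (coeff n f)) f := by
  unfold HasSum
  rw [SummationFilter.unconditional_filter,
    PolySpaces.withSeminorms_expNorm.tendsto_nhds]
  intro ρ ε hε
  -- The norm of the difference between f and its partial sum over s is the norm series of f taken
  -- outside s.
  have ht := tendsto_tsum_compl_atTop_zero
    fun n => ((ρ : ℝ) ^ n)⁻¹ * weight k n * ‖coeff n f‖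
  filter_upwards [ht.eventually (gt_mem_nhds hε)] with s hs
  refine lt_of_eq_of_lt ?_ hs
  rw [expNorm_eq]
  have h1 := tsum_subtype {n | n ∉ s} fun n => ((ρ : ℝ) ^ n)⁻¹ * weight k n * ‖coeff n f‖
  refine Eq.trans ?_ h1.symm
  refine tsum_congr fun n => ?_
  rw [map_sub, coeff_sum_ofPoly]
  by_cases hn : n ∈ s <;> simp [hn, Set.indicator]

theorem hasSum_apply_ofPoly_coeff (T : StrongDual ℂ (Θ.Exp k)) (f : Θ.Exp k) :
    HasSum (fun n => T (ofPoly k n (coeff n f))) (T f) :=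
  (hasSum_ofPoly_coeff f).mapL T

/-- The way elements of `Exp` are produced: rapidly decreasing coefficients define an entire
function with exactly these Taylor polynomials. -/
theorem exists_coeff_eq {Q : ∀ n, Θ.Space n}
    (hQ : ∀ R : ℝ, 0 < R → Summable fun n => R ^ n * weight k n * ‖Q n‖) :
    ∃ F : Θ.Exp k, ∀ n, coeff n F = Q n := by
  obtain ⟨σ, hσ, hev⟩ := Θ.exists_norm_apply_le
  obtain ⟨d, hd0, hd⟩ := exists_pow_le_weight k
  have hσ0 : 0 < σ := one_pos.trans_le hσ
  have hs : ∀ R : ℝ, 0 < R → Summable fun n => σ ^ n * ‖Q n‖ * R ^ n := fun R hR => by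
    refine (hQ (σ * R / d) (by positivity)).of_nonneg_of_le (fun n => by positivity) fun n => ?_
    calc σ ^ n * ‖Q n‖ * R ^ n = (σ * R / d) ^ n * d ^ n * ‖Q n‖ := by
          rw [div_pow, mul_pow]; field_simp
      _ ≤ _ := by gcongr; exact hd n
  have hsum : ∀ x, Summable fun n => (Q n).1 x := fun x => by
    refine Summable.of_norm_bounded (hs (‖x‖ + 1) (by positivity)) fun n => ?_
    refine (hev n (Q n) x).trans ?_
    gcongr
    linarith
  obtain ⟨hent, hdh⟩ := entire_of_hasSum (p := fun n => (Q n).1)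
    (fun n => Θ.isHomogPoly n _ (Q n).2) (b := fun n => σ ^ n * ‖Q n‖)
    (fun n => by positivity) (fun n x => hev n (Q n) x) hs (fun x => (hsum x).hasSum)
  have hreg : (fun x => ∑' n, (Q n).1 x) ∈ Θ.regular := ⟨hent, fun j => by
    rw [hdh]; exact Submodule.smul_mem _ _ (Q j).2⟩
  have htay : ∀ n, Θ.taylor n ⟨_, hreg⟩ = Q n := fun n => by
    apply Subtype.ext
    change (n.factorial : ℂ)⁻¹ • dhat n _ 0 = _
    rw [hdh, inv_smul_smul₀ (by exact_mod_cast n.factorial_ne_zero)]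
  refine ⟨.mk _ ((Submodule.mem_iInf _).2 fun ρ => ⟨hreg, ?_⟩), fun n => htay n⟩
  refine (hQ (ρ : ℝ)⁻¹ (inv_pos.2 ρ.2)).congr fun n => ?_
  rw [PolySpaces.term, htay, inv_pow]
  rfl

/-- Evaluation at a point is continuous. -/
theorem exists_eval (x : E) : ∃ T : StrongDual ℂ (Θ.Exp k), ∀ f, T f = f.toFun x := by
  obtain ⟨σ, hσ, hev⟩ := Θ.exists_norm_apply_le
  obtain ⟨d, hd0, hd⟩ := exists_pow_le_weight k
  have hσ0 : 0 < σ := one_pos.trans_le hσ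
  have hR : 0 < σ * (‖x‖ + 1) / d := by positivity
  let l : Θ.Exp k →ₗ[ℂ] ℂ :=
    { toFun := fun f => f.toFun x, map_add' := fun _ _ => rfl, map_smul' := fun _ _ => rfl }
  refine ⟨mkDual l 1 zero_le_one ⟨_, inv_pos.2 hR⟩ fun f => ?_, fun f => rfl⟩
  change ‖f.toFun x‖ ≤ _
  rw [one_mul, ← (hasSum_coeff_apply f x).tsum_eq, expNorm_eq]
  refine tsum_of_norm_bounded (summable_expNorm _ f).hasSum fun n => ?_
  refine (hev n _ x).trans ?_
  change _ ≤ ((σ * (‖x‖ + 1) / d)⁻¹ ^ n)⁻¹ * weight k n * ‖coeff n f‖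
  rw [inv_pow, inv_inv]
  calc σ ^ n * ‖coeff n f‖ * ‖x‖ ^ n ≤ σ ^ n * ‖coeff n f‖ * (‖x‖ + 1) ^ n := by
        gcongr; linarith
    _ = (σ * (‖x‖ + 1) / d) ^ n * d ^ n * ‖coeff n f‖ := by
        rw [div_pow, mul_pow]; field_simp
    _ ≤ _ := by gcongr; exact hd n

/-- An absolutely convergent double series of polynomials defines an element of `Exp`. -/
theorem exists_hasSum_double {G : ∀ n, ℕ → Θ.Space n}
    (hG : ∀ R : ℝ, 0 < R →
      Summable fun p : ℕ × ℕ => R ^ p.1 * weight k p.1 * ‖G p.1 p.2‖) :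
    ∃ F : Θ.Exp k, (∀ T : StrongDual ℂ (Θ.Exp k),
      HasSum (fun p : ℕ × ℕ => T (ofPoly k p.1 (G p.1 p.2))) (T F)) ∧
      ∀ ρ : {ρ : ℝ // 0 < ρ}, Θ.expNorm k ρ F ≤
        ∑' p : ℕ × ℕ, ((ρ : ℝ)⁻¹) ^ p.1 * weight k p.1 * ‖G p.1 p.2‖ := by
  have hfib : ∀ n, Summable fun i => ‖G n i‖ := fun n => by
    have := (hG 1 one_pos).prod_factor n
    simp only [one_pow, one_mul] at this
    exact (summable_mul_left_iff (weight_pos k n).ne').1 this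
  -- Completeness of the polynomial spaces is what allows the sum over the second index.
  have := Θ.complete
  have hsum : ∀ n, Summable (G n) := fun n => (hfib n).of_norm
  have hle : ∀ n, ‖∑' i, G n i‖ ≤ ∑' i, ‖G n i‖ := fun n => norm_tsum_le_tsum_norm (hfib n)
  have hle' : ∀ (R : ℝ), 0 < R → ∀ n, R ^ n * weight k n * ‖∑' i, G n i‖ ≤
      ∑' i, R ^ n * weight k n * ‖G n i‖ := fun R hR n => by
    rw [tsum_mul_left]
    have := weight_nonneg k n
    gcongr
    exact hle n
  have hQ : ∀ R : ℝ, 0 < R → Summable fun n => R ^ n * weight k n * ‖∑' i, G n i‖ :=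
    fun R hR => (hG R hR).prod.of_nonneg_of_le
      (fun n => by have := weight_nonneg k n; positivity) (hle' R hR)
  obtain ⟨F, hF⟩ := exists_coeff_eq hQ
  refine ⟨F, fun T => ?_, fun ρ => ?_⟩
  · obtain ⟨C, ρ, hC0, hC⟩ := exists_norm_le_expNorm T
    have hs : Summable fun p : ℕ × ℕ => T (ofPoly k p.1 (G p.1 p.2)) := by
      refine Summable.of_norm_bounded ((hG (ρ : ℝ)⁻¹ (inv_pos.2 ρ.2)).mul_left C) fun p => ?_
      refine (hC _).trans_eq ?_
      rw [expNorm_ofPoly, inv_pow]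
    -- Each row sums to T of the n-th Taylor polynomial of F, so the double sum agrees with the
    -- Taylor expansion of T F.
    have h1 := hs.hasSum.prod_fiberwise fun n =>
      ((hsum n).hasSum.mapL (restrict T n))
    have h2 := hasSum_apply_ofPoly_coeff T F
    simp only [hF] at h2
    rw [h2.unique h1]
    exact hs.hasSum
  · rw [expNorm_eq, (hG (ρ : ℝ)⁻¹ (inv_pos.2 ρ.2)).tsum_prod]
    simp only [hF, ← inv_pow]
    exact (hQ _ (inv_pos.2 ρ.2)).tsum_le_tsum (hle' _ (inv_pos.2 ρ.2))
      (hG (ρ : ℝ)⁻¹ (inv_pos.2 ρ.2)).prod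

end HolomorphyType

namespace HolomorphyType

variable {E : Type*} [NormedAddCommGroup E] [NormedSpace ℂ E] {Θ : HolomorphyType E} {k : ℝ≥0∞}

/-! ### Translation -/

/-- The part of degree `n` in `y` of `P(y + x)`, where `P` is the Taylor polynomial of `f` of
degree `n + m`. -/
def translateTerm (f : Θ.Exp k) (x : E) (n m : ℕ) : Θ.Space n :=
  ⟨((n + m).choose n : ℂ) • mixed (symForm (coeff (n + m) f)) n x,
    Submodule.smul_mem _ _ (mixed_mem (Nat.le_add_right n m) (symForm_isSymm _) (symForm_mem _) x)⟩

/-- As a normalized derivative of a Taylor polynomial at x, the term falls under the holomorphy type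
inequality. -/
theorem translateTerm_eq (f : Θ.Exp k) (x : E) (n m : ℕ) : translateTerm f x n m =
    (n.factorial : ℂ)⁻¹ • (⟨dhat n (coeff (n + m) f).1 x,
      Θ.dhat_mem n (n + m) (Nat.le_add_right n m) x (coeff (n + m) f)⟩ : Θ.poly n) := by
  apply Subtype.ext
  change _ = (n.factorial : ℂ)⁻¹ • dhat n (coeff (n + m) f).1 x
  conv_rhs => rw [eq_symForm (coeff (n + m) f)]
  rw [dhat_diag_eq_mixed (Nat.le_add_right n m) (symForm_isSymm _), smul_smul,
    Nat.descFactorial_eq_factorial_mul_choose, Nat.cast_mul,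
    inv_mul_cancel_left₀ (by exact_mod_cast n.factorial_ne_zero)]
  rfl

theorem weight_le_of_pow_le {d : ℝ} (hd0 : 0 < d) (hd : ∀ j, d ^ j ≤ weight k j) (n m : ℕ) :
    weight k n ≤ (d⁻¹) ^ m * weight k (n + m) := by
  have h := (mul_le_mul_of_nonneg_left (hd m) (weight_nonneg k n)).trans (weight_mul_le k n m)
  rw [inv_pow, ← div_eq_inv_mul, le_div_iff₀ (by positivity)]
  exact h

theorem exists_translate (f : Θ.Exp k) (x : E) :
    ∃ F : Θ.Exp k, (∀ y, F.toFun y = f.toFun (y + x)) ∧ ∀ T : StrongDual ℂ (Θ.Exp k),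
      HasSum (fun p : ℕ × ℕ => T (ofPoly k p.1 (translateTerm f x p.1 p.2))) (T F) := by
  obtain ⟨σ, hσ, hdh⟩ := Θ.exists_nrm_dhat_le
  obtain ⟨d, hd0, hd⟩ := exists_pow_le_weight k
  have hσ0 : 0 < σ := one_pos.trans_le hσ
  have hbound : ∀ n m, ‖translateTerm f x n m‖ ≤ σ ^ (n + m) * ‖coeff (n + m) f‖ * ‖x‖ ^ m := by
    intro n m
    have := hdh n (n + m) (Nat.le_add_right n m) x (coeff (n + m) f)
    rw [Nat.add_sub_cancel_left] at this
    rw [translateTerm_eq]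
    exact this
  have hG : ∀ R : ℝ, 0 < R →
      Summable fun p : ℕ × ℕ => R ^ p.1 * weight k p.1 * ‖translateTerm f x p.1 p.2‖ := by
    intro R hR
    refine (summable_tsum_le_of_le_choose (a := R) (b := ‖x‖ * d⁻¹)
      (c := fun j => σ ^ j * weight k j * ‖coeff j f‖)
      (fun p => by have := weight_nonneg k p.1; positivity) (fun n m => ?_) ?_).1
    -- The bound obtained carries no binomial coefficient; one is inserted only to fit the summation
    -- lemma.
    · have h1 : (1 : ℝ) ≤ (n + m).choose n := by
        exact_mod_cast Nat.choose_pos (Nat.le_add_right n m)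
      have h2 := weight_nonneg k (n + m)
      have h3 := weight_nonneg k n
      calc R ^ n * weight k n * ‖translateTerm f x n m‖
          ≤ R ^ n * ((d⁻¹) ^ m * weight k (n + m)) *
            (σ ^ (n + m) * ‖coeff (n + m) f‖ * ‖x‖ ^ m) := by
            gcongr
            · exact weight_le_of_pow_le hd0 hd n m
            · exact hbound n m
        _ = 1 * (R ^ n * (‖x‖ * d⁻¹) ^ m * (σ ^ (n + m) * weight k (n + m) * ‖coeff (n + m) f‖)) := by
            rw [mul_pow]; ring
        _ ≤ ((n + m).choose n : ℝ) *
            (R ^ n * (‖x‖ * d⁻¹) ^ m * (σ ^ (n + m) * weight k (n + m) * ‖coeff (n + m) f‖)) := by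
            gcongr
        _ = _ := by ring
    · refine (summable_coeff f (R := (R + ‖x‖ * d⁻¹) * σ) (by positivity)).congr fun j => ?_
      rw [mul_pow]; ring
  obtain ⟨F, hF, -⟩ := exists_hasSum_double hG
  refine ⟨F, fun y => ?_, hF⟩
  -- F is identified pointwise: evaluation at y is a continuous functional, and regrouping its
  -- double series by total degree gives the binomial expansion of f(y + x).
  obtain ⟨T, hT⟩ := exists_eval (Θ := Θ) (k := k) y
  have h1 := hasSum_sum_antidiagonal (hF T)
  rw [hT] at h1
  refine h1.unique ((hasSum_coeff_apply f (y + x)).congr_fun fun j => ?_)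
  rw [eq_symForm (coeff j f)]
  dsimp only
  rw [(symForm_isSymm _).apply_add, Finset.Nat.sum_antidiagonal_eq_sum_range_succ_mk]
  refine Finset.sum_congr rfl fun m hm => ?_
  rw [hT]
  change ((m + (j - m)).choose m : ℂ) * mixed (symForm (coeff (m + (j - m)) f)) m x y = _
  rw [Nat.add_sub_cancel' (Nat.lt_succ_iff.1 (Finset.mem_range.1 hm))]

theorem translate_mem (f : Θ.Exp k) (x : E) : (fun y => f.toFun (y + x)) ∈ Θ.expSubmodule k := by
  obtain ⟨F, hF, -⟩ := exists_translate f x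
  rw [← funext hF]
  exact F.2

theorem hasSum_apply_translate (T : StrongDual ℂ (Θ.Exp k)) (f : Θ.Exp k) (x : E) :
    HasSum (fun p : ℕ × ℕ => T (ofPoly k p.1 (translateTerm f x p.1 p.2)))
      (T (.mk _ (translate_mem f x))) := by
  obtain ⟨F, hF, h⟩ := exists_translate f x
  have : F = .mk _ (translate_mem f x) := PolySpaces.Exp.ext hF
  rw [← this]
  exact h T

/-! ### Convolution operators -/

/-- The part of degree `m` in `x` of `T(P(· + x))`, where `P` is the Taylor polynomial of `f` of
degree `n + m`. -/
def convTerm (h₂ : Θ.IsPiTwo k) (T : StrongDual ℂ (Θ.Exp k)) (f : Θ.Exp k) (m n : ℕ) : Θ.Space m :=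
  ⟨((n + m).choose n : ℂ) • Θ.applyMixed T (Nat.le_add_right n m)
      (symForm_isSymm (coeff (n + m) f)) (symForm_mem _),
    Submodule.smul_mem _ _ (by
      have := h₂.mem T (n + m) n (Nat.le_add_right n m) _
        (symForm_isSymm (coeff (n + m) f)) (symForm_mem _)
      rwa [Nat.add_sub_cancel_left] at this)⟩

theorem convTerm_apply (h₂ : Θ.IsPiTwo k) (T : StrongDual ℂ (Θ.Exp k)) (f : Θ.Exp k) (m n : ℕ)
    (x : E) : (convTerm h₂ T f m n).1 x = T (ofPoly k n (translateTerm f x n m)) :=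
  (map_smul T ((n + m).choose n : ℂ) _).symm

theorem norm_convTerm (h₂ : Θ.IsPiTwo k) (T : StrongDual ℂ (Θ.Exp k)) (f : Θ.Exp k) (m n : ℕ) :
    ‖convTerm h₂ T f m n‖ = ((n + m).choose n : ℝ) * Θ.nrm (n + m - n)
      ⟨_, h₂.mem T (n + m) n (Nat.le_add_right n m) _
        (symForm_isSymm (coeff (n + m) f)) (symForm_mem _)⟩ := by
  have h0 : Θ.applyMixed T (Nat.le_add_right n m) (symForm_isSymm (coeff (n + m) f))
      (symForm_mem _) ∈ Θ.poly m := by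
    have := h₂.mem T (n + m) n (Nat.le_add_right n m) _
      (symForm_isSymm (coeff (n + m) f)) (symForm_mem _)
    rwa [Nat.add_sub_cancel_left] at this
  rw [nrm_congr (Nat.add_sub_cancel_left (n := n) (m := m)) _ h0]
  refine (map_smul_eq_mul (Θ.nrm m) ((n + m).choose n : ℂ) ⟨_, h0⟩).trans ?_
  rw [Complex.norm_natCast]

/-- T is applied to the translation series, which is then summed by degree in x. The π₂ bound and
supermultiplicativity of the weights give summability and the continuity estimate together. -/
theorem exists_conv (h₂ : Θ.IsPiTwo k) (T : StrongDual ℂ (Θ.Exp k)) (ρ : {ρ : ℝ // 0 < ρ}) :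
    ∃ (C : ℝ) (τ : {ρ : ℝ // 0 < ρ}), 0 ≤ C ∧ ∀ f : Θ.Exp k, ∃ F : Θ.Exp k,
      (∀ x, F.toFun x = T (.mk _ (translate_mem f x))) ∧
      Θ.expNorm k ρ F ≤ C * Θ.expNorm k τ f := by
  obtain ⟨C, ρ₀, hC0, hC⟩ := exists_norm_le_expNorm T
  obtain ⟨M, hM0, hM⟩ := h₂.bound T C ρ₀ hC0 hC
  have hρ := ρ.2
  have hρ₀ := ρ₀.2
  have hterm : ∀ (f : Θ.Exp k) (R : ℝ), 0 < R → ∀ m n : ℕ,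
      R ^ m * weight k m * ‖convTerm h₂ T f m n‖ ≤ ((m + n).choose m : ℝ) * R ^ m *
        ((ρ₀ : ℝ)⁻¹) ^ n * (C * M ^ (m + n) * weight k (m + n) * ‖coeff (m + n) f‖) := by
    intro f R hR m n
    have h1 := hM (n + m) n (Nat.le_add_right n m) _ (symForm_isSymm (coeff (n + m) f))
      (symForm_mem _)
    rw [nrm_symForm] at h1
    have h2 := weight_nonneg k m
    rw [norm_convTerm]
    calc R ^ m * weight k m * (((n + m).choose n : ℝ) * _)
        ≤ R ^ m * weight k m * (((n + m).choose n : ℝ) *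
          (C * M ^ (n + m) * ((ρ₀ : ℝ) ^ n)⁻¹ * weight k n * ‖coeff (n + m) f‖)) := by gcongr
      _ = ((n + m).choose n : ℝ) * R ^ m * ((ρ₀ : ℝ)⁻¹) ^ n *
          (C * M ^ (n + m) * (weight k n * weight k m) * ‖coeff (n + m) f‖) := by
          rw [inv_pow]; ring
      _ ≤ ((n + m).choose n : ℝ) * R ^ m * ((ρ₀ : ℝ)⁻¹) ^ n *
          (C * M ^ (n + m) * weight k (n + m) * ‖coeff (n + m) f‖) := by
          gcongr
          exact weight_mul_le k n m
      _ = _ := by rw [Nat.add_comm n m, Nat.choose_symm_add]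
  have hsum : ∀ (f : Θ.Exp k) (R : ℝ), 0 < R → Summable fun j =>
      (R + (ρ₀ : ℝ)⁻¹) ^ j * (C * M ^ j * weight k j * ‖coeff j f‖) := by
    intro f R hR
    refine ((summable_coeff f (R := (R + (ρ₀ : ℝ)⁻¹) * M) (by positivity)).mul_left C).congr
      fun j => ?_
    rw [mul_pow]; ring
  have hdouble := fun (f : Θ.Exp k) (R : ℝ) (hR : 0 < R) => summable_tsum_le_of_le_choose
    (f := fun p => R ^ p.1 * weight k p.1 * ‖convTerm h₂ T f p.1 p.2‖)
    (fun p => by have := weight_nonneg k p.1; positivity) (hterm f R hR) (hsum f R hR)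
  -- The binomial theorem merges the factors ρ⁻ᵐ and ρ₀⁻ⁿ into (ρ⁻¹ + ρ₀⁻¹)ʲ and π₂ contributes Mʲ;
  -- `f` is measured in the norm whose index is the inverse of this product.
  have hR : 0 < ((ρ : ℝ)⁻¹ + (ρ₀ : ℝ)⁻¹) * M := by positivity
  refine ⟨C, ⟨_, inv_pos.2 hR⟩, hC0.le, fun f => ?_⟩
  obtain ⟨F, hF, hFn⟩ := exists_hasSum_double fun R hR => (hdouble f R hR).1
  refine ⟨F, fun x => ?_, ?_⟩
  · obtain ⟨S, hS⟩ := exists_eval (Θ := Θ) (k := k) x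
    have h1 := hF S
    rw [hS] at h1
    refine h1.unique ?_
    -- `convTerm` lists the degree in x first, the translation series the degree in y.
    rw [← (Equiv.prodComm ℕ ℕ).hasSum_iff]
    refine (hasSum_apply_translate T f x).congr_fun fun p => ?_
    change S (ofPoly k p.2 (convTerm h₂ T f p.2 p.1)) = _
    rw [hS]
    exact convTerm_apply h₂ T f p.2 p.1 x
  · refine (hFn ρ).trans ((hdouble f _ (inv_pos.2 hρ)).2.trans_eq ?_)
    rw [expNorm_eq, ← tsum_mul_left]
    refine tsum_congr fun j => ?_
    rw [inv_pow, inv_inv, mul_pow]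
    ring

theorem conv_mem (h₂ : Θ.IsPiTwo k) (T : StrongDual ℂ (Θ.Exp k)) (f : Θ.Exp k) :
    (fun x => T (.mk _ (translate_mem f x))) ∈ Θ.expSubmodule k := by
  obtain ⟨C, τ, -, h⟩ := exists_conv h₂ T ⟨1, one_pos⟩
  obtain ⟨F, hF, -⟩ := h f
  rw [← funext hF]
  exact F.2

theorem convWellDefined (h₂ : Θ.IsPiTwo k) : Θ.ConvWellDefined k where
  translate_mem := translate_mem
  conv_mem := conv_mem h₂
  conv_continuous T := by
    let l : Θ.Exp k →ₗ[ℂ] Θ.Exp k :=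
      { toFun := fun f => .mk _ (conv_mem h₂ T f)
        map_add' := fun f g => PolySpaces.Exp.ext fun x =>
          map_add T (.mk _ (translate_mem f x)) (.mk _ (translate_mem g x))
        map_smul' := fun c f => PolySpaces.Exp.ext fun x =>
          map_smul T c (.mk _ (translate_mem f x)) }
    refine WithSeminorms.continuous_of_isBounded PolySpaces.withSeminorms_expNorm
      PolySpaces.withSeminorms_expNorm l fun ρ => ?_
    obtain ⟨C, τ, hC0, h⟩ := exists_conv h₂ T ρ
    refine ⟨{τ}, ⟨C, hC0⟩, fun f => ?_⟩
    obtain ⟨F, hF, hle⟩ := h f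
    have : l f = F := PolySpaces.Exp.ext fun x => (hF x).symm
    rw [Finset.sup_singleton]
    change Θ.expNorm k ρ (l f) ≤ C * Θ.expNorm k τ f
    rw [this]
    exact hle

end HolomorphyType

namespace HolomorphyType

variable {E : Type*} [NormedAddCommGroup E] [NormedSpace ℂ E] {Θ : HolomorphyType E}
  {k k' : ℝ≥0∞}

/-! ### The polynomials on the dual space -/

/-- The map `(φ₁, …, φₙ) ↦ φ₁(x) ⋯ φₙ(x)`. -/
def prodAt (n : ℕ) (x : E) : MultilinearMap ℂ (fun _ : Fin n => StrongDual ℂ E) ℂ :=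
  (MultilinearMap.mkPiAlgebra ℂ (Fin n) ℂ).compLinearMap
    fun _ => (ContinuousLinearMap.apply ℂ ℂ x).toLinearMap

theorem prodAt_apply {n : ℕ} (x : E) (φ : Fin n → StrongDual ℂ E) :
    prodAt n x φ = ∏ i, φ i x := rfl

theorem prodAt_perm {n : ℕ} (x : E) (s : Equiv.Perm (Fin n)) (φ : Fin n → StrongDual ℂ E) :
    prodAt n x (fun i => φ (s i)) = prodAt n x φ :=
  Equiv.prod_comp s fun i => φ i x

/-- Polarization writes φ₁ ⋯ φₙ as a combination of n-th powers of partial sums of the φᵢ. -/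
theorem prodAt_mem_finiteType {n : ℕ} (φ : Fin n → StrongDual ℂ E) :
    (fun x => prodAt n x φ) ∈ finiteType E n := by
  have h : (fun x => prodAt n x φ) = (n.factorial : ℂ)⁻¹ • ∑ T : Finset (Fin n),
      (-1 : ℂ) ^ T.card • fun x => (∑ i ∈ Tᶜ, φ i) x ^ n := by
    funext x
    rw [Pi.smul_apply, Finset.sum_apply, ← inv_smul_smul₀ (show (n.factorial : ℂ) ≠ 0 by
      exact_mod_cast n.factorial_ne_zero) (prodAt n x φ), ← polarization _ (prodAt_perm x)]
    simp [prodAt_apply]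
  rw [h]
  exact Submodule.smul_mem _ _ (Submodule.sum_mem _ fun T _ =>
    Submodule.smul_mem _ _ (pow_mem_finiteType _ n))

/-- The map `(φ₁, …, φₙ) ↦ φ₁ ⋯ φₙ` into the `n`-th space of polynomials. -/
def prodElem (h : Θ.IsPiOne) (n : ℕ) :
    MultilinearMap ℂ (fun _ : Fin n => StrongDual ℂ E) (Θ.Space n) where
  toFun φ := ⟨fun x => prodAt n x φ, h.finiteType_le n (prodAt_mem_finiteType φ)⟩
  map_update_add' φ i a b := Subtype.ext <| funext fun x => (prodAt n x).map_update_add φ i a b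
  map_update_smul' φ i c a := Subtype.ext <| funext fun x => (prodAt n x).map_update_smul φ i c a

theorem prodElem_diag (h : Θ.IsPiOne) (n : ℕ) (φ : StrongDual ℂ E) :
    prodElem h n (fun _ => φ) = powElem h φ n := by
  apply Subtype.ext
  funext x
  change prodAt n x (fun _ => φ) = φ x ^ n
  simp [prodAt_apply]

theorem exists_norm_powElem_le (h : Θ.IsPiOne) : ∃ K : ℝ, 0 < K ∧
    ∀ (φ : StrongDual ℂ E) (n : ℕ), ‖powElem h φ n‖ ≤ K ^ n * ‖φ‖ ^ n := by
  obtain ⟨K, hK0, hK⟩ := h.exists_nrm_le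
  refine ⟨K, hK0, fun φ n => ?_⟩
  have := hK φ 1 n
  rwa [norm_one, mul_one, one_smul] at this

/-- The multilinear form behind the Borel transform is (φ₁, …, φₙ) ↦ S(φ₁ ⋯ φₙ). The π₁ inequality
controls only powers φⁿ; polarization extends the bound off the diagonal. -/
theorem isHomogPoly_borel (h : Θ.IsPiOne) (n : ℕ) (S : StrongDual ℂ (Θ.Space n)) :
    IsHomogPoly n (borel h n S) := by
  obtain ⟨K, hK0, hK⟩ := exists_norm_powElem_le h
  let A : MultilinearMap ℂ (fun _ : Fin n => StrongDual ℂ E) ℂ :=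
    S.toLinearMap.compMultilinearMap (prodElem h n)
  have hA : ∀ φ, A (fun _ => φ) = borel h n S φ := fun φ => congrArg S (prodElem_diag h n φ)
  refine ⟨A.mkContinuous _ (norm_multilinear_le_of_norm_diag_le A (fun s φ => congrArg S
    (Subtype.ext (funext fun x => prodAt_perm x s φ))) (C := ‖S‖ * K ^ n) (by positivity)
    fun φ => ?_), fun φ => (hA φ).symm⟩
  rw [hA, mul_assoc]
  refine (S.le_opNorm _).trans ?_
  gcongr
  exact hK φ n

theorem nrm_dual_borel (h : Θ.IsPiOne) (n : ℕ) (S : StrongDual ℂ (Θ.Space n)) :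
    (dual h).nrm n ⟨borel h n S, S, rfl⟩ = ‖S‖ := by
  change ‖(LinearEquiv.ofInjective (borel h n) (borel_injective h n)).symm _‖ = _
  congr 1
  exact (LinearEquiv.ofInjective (borel h n) (borel_injective h n)).symm_apply_apply S

/-! ### Exponentials -/

theorem exists_exp (h : Θ.IsPiOne) (hk : (k.toReal)⁻¹ < 1) (φ : StrongDual ℂ E) :
    ∃ F : Θ.Exp k, (∀ x, F.toFun x = Complex.exp (φ x)) ∧
      ∀ n, coeff n F = (n.factorial : ℂ)⁻¹ • powElem h φ n := by
  obtain ⟨K, hK0, hK⟩ := exists_norm_powElem_le h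
  have hs : ∀ R : ℝ, 0 < R → Summable fun n : ℕ =>
      R ^ n * weight k n * ‖(n.factorial : ℂ)⁻¹ • powElem h φ n‖ := fun R hR => by
    refine (summable_weight_div_factorial hk (R := R * K * (‖φ‖ + 1)) (by positivity)).of_nonneg_of_le
      (fun n => by have := weight_nonneg k n; positivity) fun n => ?_
    have := weight_nonneg k n
    rw [norm_smul, norm_inv, Complex.norm_natCast]
    calc _ ≤ R ^ n * weight k n * ((n.factorial : ℝ)⁻¹ * (K ^ n * (‖φ‖ + 1) ^ n)) := by
          gcongr
          refine (hK φ n).trans ?_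
          gcongr
          linarith
      _ = _ := by rw [mul_pow, mul_pow]; ring
  obtain ⟨F, hF⟩ := exists_coeff_eq hs
  refine ⟨F, fun x => ?_, hF⟩
  have h1 := hasSum_coeff_apply F x
  simp only [hF] at h1
  refine h1.unique ?_
  rw [Complex.exp_eq_exp_ℂ]
  refine (NormedSpace.expSeries_div_hasSum_exp (φ x)).congr_fun fun n => ?_
  rw [div_eq_inv_mul]
  rfl

theorem exp_mem (h : Θ.IsPiOne) (hk : (k.toReal)⁻¹ < 1) (φ : StrongDual ℂ E) :
    (fun x => Complex.exp (φ x)) ∈ Θ.expSubmodule k := by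
  obtain ⟨F, hF, -⟩ := exists_exp h hk φ
  rw [← funext hF]
  exact F.2

/-- The exponential `e^φ` as an element of `Exp`. -/
def expElem (h : Θ.IsPiOne) (hk : (k.toReal)⁻¹ < 1) (φ : StrongDual ℂ E) : Θ.Exp k :=
  .mk _ (exp_mem h hk φ)

theorem coeff_expElem (h : Θ.IsPiOne) (hk : (k.toReal)⁻¹ < 1) (φ : StrongDual ℂ E) (n : ℕ) :
    coeff n (expElem h hk φ) = (n.factorial : ℂ)⁻¹ • powElem h φ n := by
  obtain ⟨F, hF, hF'⟩ := exists_exp h hk φ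
  rw [← hF' n]
  congr 1
  exact PolySpaces.Exp.ext fun x => (hF x).symm

/-! ### The Fourier–Borel transform -/

/-- The Fourier–Borel transform as a linear map into the functions on the dual of `E`. -/
def fourierBorel (h : Θ.IsPiOne) (hk : (k.toReal)⁻¹ < 1) :
    StrongDual ℂ (Θ.Exp k) →ₗ[ℂ] (StrongDual ℂ E → ℂ) where
  toFun T φ := T (expElem h hk φ)
  map_add' _ _ := rfl
  map_smul' _ _ := rfl

theorem hasSum_fourierBorel (h : Θ.IsPiOne) (hk : (k.toReal)⁻¹ < 1) (T : StrongDual ℂ (Θ.Exp k))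
    (φ : StrongDual ℂ E) : HasSum (fun n : ℕ => ((n.factorial : ℂ)⁻¹ • borel h n (restrict T n)) φ)
      (fourierBorel h hk T φ) := by
  refine (hasSum_apply_ofPoly_coeff T (expElem h hk φ)).congr_fun fun n => ?_
  rw [coeff_expElem, map_smul, map_smul]
  rfl

/-- Applying T to the exponential series gives a series of homogeneous polynomials in φ; the factor
1/n! outweighs the growth of the restrictions, so it converges everywhere. -/
theorem fourierBorel_entire (h : Θ.IsPiOne) (hk : (k.toReal)⁻¹ < 1)
    (T : StrongDual ℂ (Θ.Exp k)) : Entire (fourierBorel h hk T) ∧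
      ∀ n, dhat n (fourierBorel h hk T) 0 = borel h n (restrict T n) := by
  obtain ⟨K, hK0, hK⟩ := exists_norm_powElem_le h
  obtain ⟨C, ρ, hC0, hC⟩ := exists_norm_le_expNorm T
  have hρ := ρ.2
  obtain ⟨h1, h2⟩ := entire_of_hasSum
    (p := fun n : ℕ => (n.factorial : ℂ)⁻¹ • borel h n (restrict T n))
    (fun n => by
      rw [← map_smul]
      exact isHomogPoly_borel h n _)
    (b := fun n => (n.factorial : ℝ)⁻¹ * (‖restrict T n‖ * K ^ n)) (fun n => by positivity)
    (fun n φ => by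
      rw [Pi.smul_apply, norm_smul, norm_inv, Complex.norm_natCast, mul_assoc, mul_assoc]
      gcongr
      refine ((restrict T n).le_opNorm _).trans ?_
      gcongr
      exact hK φ n)
    (fun R hR => by
      refine ((summable_weight_div_factorial hk (R := (ρ : ℝ)⁻¹ * K * R) (by positivity)).mul_left
        C).of_nonneg_of_le (fun n => by positivity) fun n => ?_
      calc _ ≤ (n.factorial : ℝ)⁻¹ * (C * (((ρ : ℝ) ^ n)⁻¹ * weight k n) * K ^ n) * R ^ n := by
            gcongr
            exact norm_restrict_le hC0.le hC n
        _ = _ := by rw [mul_pow, mul_pow, inv_pow]; ring)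
    (hasSum_fourierBorel h hk T)
  refine ⟨h1, fun n => ?_⟩
  rw [h2, smul_inv_smul₀ (by exact_mod_cast n.factorial_ne_zero)]

theorem term_dual_eq (h : Θ.IsPiOne) {g : StrongDual ℂ E → ℂ} (hg : g ∈ (dual h).regular)
    (ρ : ℝ) (n : ℕ) {S : StrongDual ℂ (Θ.Space n)} (hS : dhat n g 0 = borel h n S) :
    (dual h).term k' ρ n ⟨g, hg⟩ = (ρ ^ n)⁻¹ * weight k' n * ((n.factorial : ℝ)⁻¹ * ‖S‖) := by
  unfold PolySpaces.term
  have h1 : (dual h).taylor n ⟨g, hg⟩ = (n.factorial : ℂ)⁻¹ • ⟨borel h n S, S, rfl⟩ := by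
    apply Subtype.ext
    change (n.factorial : ℂ)⁻¹ • dhat n g 0 = _
    rw [hS]
    rfl
  rw [h1, map_smul_eq_mul, nrm_dual_borel, norm_inv, Complex.norm_natCast]

/-- Equal transforms have equal derivatives at 0, so the functionals agree on homogeneous
polynomials, hence on every Taylor series. -/
theorem fourierBorel_injective (h : Θ.IsPiOne) (hk : (k.toReal)⁻¹ < 1) :
    Function.Injective (fourierBorel h hk) := by
  intro T S hTS
  have h1 : ∀ n, restrict T n = restrict S n := fun n => by
    apply borel_injective h n
    rw [← (fourierBorel_entire h hk T).2, ← (fourierBorel_entire h hk S).2, hTS]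
  refine ContinuousLinearMap.ext fun f => ?_
  refine (hasSum_apply_ofPoly_coeff T f).unique ((hasSum_apply_ofPoly_coeff S f).congr_fun
    fun n => ?_)
  rw [← restrict_apply, ← restrict_apply, h1]

theorem range_fourierBorel (h : Θ.IsPiOne) (hk : (k.toReal)⁻¹ < 1)
    (hkk' : (k.toReal)⁻¹ + (k'.toReal)⁻¹ = 1) :
    Set.range (fourierBorel h hk) = (dual h).expUnion k' := by
  obtain ⟨c, hc0, hc⟩ := exists_weight_mul_weight hkk'
  ext g
  constructor
  · rintro ⟨T, rfl⟩
    obtain ⟨C, ρ, hC0, hC⟩ := exists_norm_le_expNorm T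
    have hρ := ρ.2
    obtain ⟨h1, h2⟩ := fourierBorel_entire h hk T
    have hreg : fourierBorel h hk T ∈ (dual h).regular := ⟨h1, fun n => ⟨_, (h2 n).symm⟩⟩
    -- The factor c/ρ cancels the geometric losses, and the factor 2 leaves a convergent geometric
    -- series.
    have hτ : 0 < 2 * c * (ρ : ℝ)⁻¹ := by positivity
    refine Set.mem_iUnion.2 ⟨⟨_, hτ⟩, hreg, ?_⟩
    refine (summable_geometric_two.mul_left C).of_nonneg_of_le
      (fun n => PolySpaces.term_nonneg _ hτ n _) fun n => ?_
    rw [term_dual_eq h hreg _ n (h2 n)]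
    change ((2 * c * (ρ : ℝ)⁻¹) ^ n)⁻¹ * weight k' n * _ ≤ _
    have hw := weight_nonneg k' n
    have hn : (0 : ℝ) < n.factorial := by positivity
    calc _ ≤ ((2 * c * (ρ : ℝ)⁻¹) ^ n)⁻¹ * weight k' n *
          ((n.factorial : ℝ)⁻¹ * (C * (((ρ : ℝ) ^ n)⁻¹ * weight k n))) := by
          gcongr
          exact norm_restrict_le hC0.le hC n
      _ = C * ((2 * c) ^ n)⁻¹ * (n.factorial : ℝ)⁻¹ * (weight k n * weight k' n) := by
          rw [mul_pow (2 * c), inv_pow]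
          field_simp
      _ ≤ C * ((2 * c) ^ n)⁻¹ * (n.factorial : ℝ)⁻¹ * (c ^ n * n.factorial) := by
          exact mul_le_mul_of_nonneg_left (hc n).2 (by positivity)
      _ = _ := by
          rw [mul_pow, one_div, inv_pow]
          field_simp
  · intro hg
    obtain ⟨ρ, hreg, hsum⟩ := Set.mem_iUnion.1 hg
    have hρ := ρ.2
    choose S hS using hreg.2
    have hterm : ∀ n, (dual h).term k' ρ n ⟨g, hreg⟩ = _ :=
      fun n => term_dual_eq h hreg ρ n (hS n).symm
    set C := ∑' n, (dual h).term k' ρ n ⟨g, hreg⟩ with hC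
    have hC0 : 0 ≤ C := tsum_nonneg fun n => PolySpaces.term_nonneg _ hρ n _
    -- A single term of the convergent series is at most its sum C; dividing by weight k' n and
    -- using n! ≤ cⁿ weight k n weight k' n bounds S n.
    have hSn : ∀ n, ‖S n‖ ≤ C * ((c * ρ) ^ n * weight k n) := fun n => by
      have h1 := hsum.le_tsum n fun m _ => PolySpaces.term_nonneg _ hρ m _
      rw [← hC, hterm n] at h1
      have hw := weight_pos k n
      have hw' := weight_pos k' n
      have hn : (0 : ℝ) < n.factorial := by positivity
      have hρn : (0 : ℝ) < (ρ : ℝ) ^ n := by positivity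
      refine le_of_mul_le_mul_left ?_
        (show 0 < ((ρ : ℝ) ^ n)⁻¹ * weight k' n * (n.factorial : ℝ)⁻¹ by positivity)
      calc _ = ((ρ : ℝ) ^ n)⁻¹ * weight k' n * ((n.factorial : ℝ)⁻¹ * ‖S n‖) := by ring
        _ ≤ C := h1
        _ = C * (n.factorial * (n.factorial : ℝ)⁻¹) := by
            rw [mul_inv_cancel₀ hn.ne', mul_one]
        _ ≤ C * (c ^ n * (weight k n * weight k' n) * (n.factorial : ℝ)⁻¹) := by
            gcongr
            exact (hc n).1
        _ = _ := by
            rw [mul_pow]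
            field_simp
    have hR : 0 < c * (ρ : ℝ) := by positivity
    have hle : ∀ (f : Θ.Exp k) n, ‖S n (coeff n f)‖ ≤
        C * ((c * ρ) ^ n * weight k n * ‖coeff n f‖) := fun f n => by
      refine ((S n).le_opNorm _).trans ?_
      rw [← mul_assoc]
      gcongr
      exact hSn n
    have hs : ∀ f : Θ.Exp k, Summable fun n => S n (coeff n f) := fun f =>
      Summable.of_norm_bounded ((summable_coeff f hR).mul_left C) (hle f)
    -- The preimage of g acts degree by degree, through the functionals whose Borel transforms are
    -- the derivatives of g at 0.
    let l : Θ.Exp k →ₗ[ℂ] ℂ :=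
      { toFun := fun f => ∑' n, S n (coeff n f)
        map_add' := fun f f' => by
          rw [← (hs f).tsum_add (hs f')]
          exact tsum_congr fun n => by rw [map_add, map_add]
        map_smul' := fun a f => by
          rw [RingHom.id_apply, smul_eq_mul, ← tsum_mul_left]
          exact tsum_congr fun n => by rw [map_smul, map_smul, smul_eq_mul] }
    refine ⟨mkDual l C hC0 ⟨_, inv_pos.2 hR⟩ fun f => ?_, ?_⟩
    · rw [expNorm_eq, ← tsum_mul_left]
      refine tsum_of_norm_bounded ((summable_expNorm _ f).mul_left C).hasSum fun n => ?_
      refine (hle f n).trans_eq ?_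
      change _ = C * (((c * (ρ : ℝ))⁻¹ ^ n)⁻¹ * weight k n * ‖coeff n f‖)
      rw [inv_pow, inv_inv]
    · funext φ
      change ∑' n, S n (coeff n (expElem h hk φ)) = g φ
      refine HasSum.tsum_eq ((hreg.1.hasSum φ).congr_fun fun n => ?_)
      rw [coeff_expElem, map_smul, ← hS n]
      rfl

/-- Exponentials are common eigenvectors of the translations, hence of all convolution operators;
multiplicativity of the transform follows from this. -/
theorem translate_expElem (W : Θ.ConvWellDefined k) (h : Θ.IsPiOne) (hk : (k.toReal)⁻¹ < 1)
    (φ : StrongDual ℂ E) (x : E) :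
    W.translate x (expElem h hk φ) = Complex.exp (φ x) • expElem h hk φ :=
  PolySpaces.Exp.ext fun y => by
    change Complex.exp (φ (y + x)) = Complex.exp (φ x) * Complex.exp (φ y)
    rw [map_add, Complex.exp_add, mul_comm]

theorem convOp_expElem (W : Θ.ConvWellDefined k) (h : Θ.IsPiOne) (hk : (k.toReal)⁻¹ < 1)
    (T : StrongDual ℂ (Θ.Exp k)) (φ : StrongDual ℂ E) :
    W.convOp T (expElem h hk φ) = T (expElem h hk φ) • expElem h hk φ :=
  PolySpaces.Exp.ext fun x => by
    rw [W.convOp_apply, translate_expElem, map_smul, smul_eq_mul, mul_comm]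
    rfl

/-- The Fourier–Borel transform as a homomorphism of algebras. -/
def fourierBorelHom (W : Θ.ConvWellDefined k) (h : Θ.IsPiOne) (hk : (k.toReal)⁻¹ < 1) :
    W.Alg →ₐ[ℂ] (StrongDual ℂ E → ℂ) :=
  AlgHom.ofLinearMap
    { toFun := fun T => fourierBorel h hk T.toDual
      map_add' := fun _ _ => rfl
      map_smul' := fun _ _ => rfl }
    (funext fun φ => by
      change Complex.exp (φ 0) = 1
      rw [map_zero, Complex.exp_zero])
    (fun T₁ T₂ => funext fun φ => by
      change (T₁ * T₂).toDual (expElem h hk φ) =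
        T₁.toDual (expElem h hk φ) * T₂.toDual (expElem h hk φ)
      rw [ConvWellDefined.Alg.mul_apply, convOp_expElem, map_smul, smul_eq_mul, mul_comm])

end HolomorphyType

/-! ### Conjugate exponents as real numbers, and the theorem -/

theorem toReal_inv_lt_one {k : ℝ≥0∞} (hk : 1 < k) : (k.toReal)⁻¹ < 1 := by
  rw [← ENNReal.toReal_inv, ← ENNReal.toReal_one]
  exact (ENNReal.toReal_lt_toReal (by simpa using (zero_lt_one.trans hk).ne') (by simp)).2
    (ENNReal.inv_lt_one.2 hk)

theorem toReal_inv_add_toReal_inv {k k' : ℝ≥0∞} (h : k⁻¹ + k'⁻¹ = 1) :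
    (k.toReal)⁻¹ + (k'.toReal)⁻¹ = 1 := by
  have h1 : k⁻¹ + k'⁻¹ ≠ ⊤ := by rw [h]; simp
  obtain ⟨h2, h3⟩ := ENNReal.add_ne_top.1 h1
  rw [← ENNReal.toReal_inv, ← ENNReal.toReal_inv, ← ENNReal.toReal_add h2 h3, h,
    ENNReal.toReal_one]

end FourierBorel

end

theorem theorem3p12 {E : Type*} [NormedAddCommGroup E] [NormedSpace ℂ E] [CompleteSpace E]
    (Θ : FourierBorel.HolomorphyType E) (k k' : ENNReal) (hk : 1 < k) (hkk' : k⁻¹ + k'⁻¹ = 1)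
    (h₁ : Θ.IsPiOne) (h₂ : Θ.IsPiTwo k) :
    ∃ (hexp : ∀ φ : StrongDual ℂ E, (fun x => Complex.exp (φ x)) ∈ Θ.expSubmodule k)
      (W : Θ.ConvWellDefined k) (S : Subalgebra ℂ (StrongDual ℂ E → ℂ)) (F : W.Alg ≃ₐ[ℂ] S),
      (S : Set (StrongDual ℂ E → ℂ)) = (FourierBorel.HolomorphyType.dual h₁).expUnion k' ∧
      ∀ (T : W.Alg) (φ : StrongDual ℂ E),
        (F T : StrongDual ℂ E → ℂ) φ = T.toDual (.mk (fun x => Complex.exp (φ x)) (hexp φ)) := by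
  have hk1 := FourierBorel.toReal_inv_lt_one hk
  have hsum := FourierBorel.toReal_inv_add_toReal_inv hkk'
  let W := FourierBorel.HolomorphyType.convWellDefined h₂
  let Φ := FourierBorel.HolomorphyType.fourierBorelHom W h₁ hk1
  have hinj : Function.Injective Φ := FourierBorel.HolomorphyType.fourierBorel_injective h₁ hk1
  -- With the range of Φ as subalgebra, closure of the target space under products requires no
  -- separate proof.
  exact ⟨FourierBorel.HolomorphyType.exp_mem h₁ hk1, W, Φ.range, AlgEquiv.ofInjective Φ hinj,
    FourierBorel.HolomorphyType.range_fourierBorel h₁ hk1 hsum, fun T φ => rfl⟩
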